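/- Let $\ell\ge 2$. Box $(r,c)$ (row $r$, column $c$) of a partition has residue $c-r \bmod \ell$; a partition is an $\ell$-core if none of its hook lengths is divisible by $\ell$; two nonempty rows are equivalent if their rightmost boxes have the same residue. The affine symmetric group $\widetilde{S_\ell}$ is generated by the transformations $s_0,\dots,s_{\ell-1}$ of $V=\{(b_0,\dots,b_{\ell-1})\in\mathbf R^\ell:\sum b_i=0\}$, where $s_i$ ($i\ge1$) exchanges $b_{i-1}$ and $b_i$, and $s_0(b)=(b_{\ell-1}+1,b_1,\dots,b_{\ell-2},b_0-1)$ ($\widetilde{S_1}$ is trivial). Write $l$ for the Coxeter length and $S_\ell=\langle s_1,\dots,s_{\ell-1}\rangle$. For $w\in\widetilde{S_\ell}$ let $w(\emptyset)$ be the $\ell$-core whose abacus has beads on runner $i$ exactly down to level $w(0)_i$; it indexes the coset $wS_\ell$. The canonical word of an $\ell$-core $\lambda$ is defined recursively: it is empty for $\lambda=\emptyset$; otherwise $w(\lambda)=s_i\,w(\widehat\lambda)$, where $i$ is the residue of the rightmost box of the bottom row of $\lambda$ and $\widehat\lambda$ is $\lambda$ with all boxes of residue $i$ at the end of both their row and their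 column removed. For an $\ell$-core $\lambda$ with first part $\lambda_1=k$ let $\Phi_\ell^k(\lambda)$ be the partition obtained by deleting from an $\ell$-runner abacus of $\lambda$ the runner containing the largest bead and renumbering the remaining runners, in order, $0,\dots,\ell-2$. **Theorem.** Let $\lambda$ be an $\ell$-core with $\lambda_1=k$ and canonical word $w(\lambda)=s_{i_1}\cdots s_{i_p}$. Then: 1. $w(\lambda)$ is a reduced word of the minimal length coset representative in $\widetilde{S_\ell}/S_\ell$ indexed by $\lambda$. For each $j\in\{1,\dots,p\}$ the core $\lambda^{(j)}=s_{i_j}s_{i_{j+1}}\cdots s_{i_p}(\emptyset)$ is nonempty and the last box of its last row has residue $i_j$. 2. $\Phi_\ell^k(\lambda)$ is an $(\ell-1)$-core with first part at most $k$. 3. Let $J$ be the set of $j\in\{1,\dots,p\}$ such that the first and the last row of $\lambda^{(j)}$ are not equivalent. Take the subword of $w(\lambda)$ at the positions in $J$, and replace each of its letters $i_j$ by the residue modulo $\ell-1$ that the last box of the last row of $\lambda^{(j)}$ has after all rows of $\lambda$ equivalent to the first row of $\lambda$ are deleted from the diagram of $\lambda$. The result is the canonical word of $\Phi_\ell^k(\lambda)$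 (with respect to $\ell-1$), and it is a reduced word of the minimal length coset representative in $\widetilde{S_{\ell-1}}/S_{\ell-1}$ indexed by $\Phi_\ell^k(\lambda)$. 4. Consequently $l(w(\Phi_\ell^k(\lambda)))=l(w(\lambda))-k$. -/

import Mathlib

/-! ### Young diagrams: residues, hook lengths, cores

A partition is a `YoungDiagram`; rows and columns are numbered from `0`, so that row `p` of the
code is row `p + 1` of the usual convention.  Residues modulo `ℓ` are elements of `ZMod ℓ`. -/

/-- The residue modulo `ℓ` of the box `c = (row, column)`. -/
def residue (ℓ : ℕ) (c : ℕ × ℕ) : ZMod ℓ := (c.2 : ZMod ℓ) - (c.1 : ZMod ℓ)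

/-- The hook length of a box `c` of `μ`: arm, plus leg, plus the box itself. -/
def hookLength (μ : YoungDiagram) (c : ℕ × ℕ) : ℕ :=
  (μ.rowLen c.1 - (c.2 + 1)) + (μ.colLen c.2 - (c.1 + 1)) + 1

/-- `μ` is an `ℓ`-core: no hook length is divisible by `ℓ`. -/
def IsCore (ℓ : ℕ) (μ : YoungDiagram) : Prop :=
  ∀ c ∈ μ, ¬ ℓ ∣ hookLength μ c

/-- The rightmost box of the (nonempty) row `p`. -/
def rowEnd (μ : YoungDiagram) (p : ℕ) : ℕ × ℕ := (p, μ.rowLen p - 1)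

/-- The index of the bottom row of a nonempty diagram. -/
def lastRow (μ : YoungDiagram) : ℕ := μ.colLen 0 - 1

/-- The rightmost box of the bottom row of a nonempty diagram. -/
def lastBox (μ : YoungDiagram) : ℕ × ℕ := rowEnd μ (lastRow μ)

/-- Two nonempty rows are equivalent if their rightmost boxes have the same residue. -/
def RowEquiv (ℓ : ℕ) (μ : YoungDiagram) (p q : ℕ) : Prop :=
  residue ℓ (rowEnd μ p) = residue ℓ (rowEnd μ q)

instance (ℓ : ℕ) (μ : YoungDiagram) (p q : ℕ) : Decidable (RowEquiv ℓ μ p q) :=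
  inferInstanceAs (Decidable (_ = _))

/-! ### The canonical word of a core -/

/-- A box of `μ` that lies at the end of its row and of its column. -/
def IsRemovable (μ : YoungDiagram) (c : ℕ × ℕ) : Prop :=
  c ∈ μ ∧ (c.1, c.2 + 1) ∉ μ ∧ (c.1 + 1, c.2) ∉ μ

instance (μ : YoungDiagram) (c : ℕ × ℕ) : Decidable (IsRemovable μ c) :=
  inferInstanceAs (Decidable (_ ∧ _))

/-- Remove from `μ` all removable boxes of residue `i`.  This is how the generator `s_i` acts on a
core of which it is a descent. -/
def removeResidue (ℓ : ℕ) (i : ZMod ℓ) (μ : YoungDiagram) : YoungDiagram where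
  cells := μ.cells.filter fun c => ¬ (IsRemovable μ c ∧ residue ℓ c = i)
  isLowerSet := by
    rintro ⟨a, b⟩ ⟨c, d⟩ hle hab
    obtain ⟨h1, h2⟩ : c ≤ a ∧ d ≤ b := hle
    simp only [Finset.coe_filter, Set.mem_ofPred_eq, YoungDiagram.mem_cells] at hab ⊢
    refine ⟨μ.up_left_mem h1 h2 hab.1, fun h => ?_⟩
    rcases eq_or_lt_of_le h1 with rfl | h1'
    · rcases eq_or_lt_of_le h2 with rfl | h2'
      · exact hab.2 h
      · exact h.1.2.1 (μ.up_left_mem le_rfl h2' hab.1)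
    · exact h.1.2.2 (μ.up_left_mem h1' h2 hab.1)

theorem lastBox_isRemovable {μ : YoungDiagram} (h : μ ≠ ⊥) : IsRemovable μ (lastBox μ) := by
  have h0 : 0 < μ.colLen 0 := by
    by_contra hc
    apply h
    ext ⟨a, b⟩
    simp only [YoungDiagram.mem_cells, YoungDiagram.notMem_bot, iff_false]
    intro hab
    have := YoungDiagram.mem_iff_lt_colLen.1 (μ.up_left_mem le_rfl (Nat.zero_le b) hab)
    omega
  have h1 : 0 < μ.rowLen (lastRow μ) := by
    rw [← YoungDiagram.mem_iff_lt_rowLen, YoungDiagram.mem_iff_lt_colLen, lastRow]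
    omega
  refine ⟨?_, ?_, ?_⟩
  · show (lastRow μ, μ.rowLen (lastRow μ) - 1) ∈ μ
    rw [YoungDiagram.mem_iff_lt_rowLen]
    omega
  · show (lastRow μ, μ.rowLen (lastRow μ) - 1 + 1) ∉ μ
    rw [YoungDiagram.mem_iff_lt_rowLen]
    omega
  · show (lastRow μ + 1, μ.rowLen (lastRow μ) - 1) ∉ μ
    intro hc
    have := YoungDiagram.mem_iff_lt_colLen.1 (μ.up_left_mem le_rfl (Nat.zero_le _) hc)
    rw [lastRow] at this
    omega

theorem card_removeResidue_lt (ℓ : ℕ) {μ : YoungDiagram} (h : μ ≠ ⊥) :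
    (removeResidue ℓ (residue ℓ (lastBox μ)) μ).card < μ.card := by
  refine Finset.card_lt_card (s := μ.cells.filter fun c =>
    ¬ (IsRemovable μ c ∧ residue ℓ c = residue ℓ (lastBox μ))) (t := μ.cells) ?_
  rw [Finset.ssubset_iff_of_subset (Finset.filter_subset _ _)]
  refine ⟨lastBox μ, (lastBox_isRemovable h).1, ?_⟩
  simp [lastBox_isRemovable h]

open Classical in
/-- The canonical word `[i₁, …, i_p]` of a core `μ`, standing for `w(μ) = s_{i₁} ⋯ s_{i_p}`: it is
empty for the empty diagram; otherwise its first letter `i` is the residue of the rightmost box of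
the bottom row, followed by the canonical word of the core obtained by removing all removable boxes
of residue `i`. -/
noncomputable def canonicalWord (ℓ : ℕ) (μ : YoungDiagram) : List (ZMod ℓ) :=
  if h : μ = ⊥ then []
  else residue ℓ (lastBox μ) :: canonicalWord ℓ (removeResidue ℓ (residue ℓ (lastBox μ)) μ)
  termination_by μ.card
  decreasing_by exact card_removeResidue_lt ℓ h

/-! ### Abaci

An abacus is recorded by the set of its beads; the entry of runner `i` on level `r` is the integer
`r * ℓ + i`. -/

/-- An abacus of `μ`: the first bead (in decreasing order) is `μ₁ - 1`, the second `μ₂ - 2`, and so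
on. All other abaci of `μ` are translates of this one. -/
def abacus (μ : YoungDiagram) : Set ℤ :=
  {x | ∃ p : ℕ, x = (μ.rowLen p : ℤ) - (p + 1)}

/-- The boxes of the partition of an abacus: the part belonging to a bead `b` is the number of gaps
before `b`, and it is one of the first `i + 1` parts iff there are at most `i` beads after `b`. -/
def abacusCells (A : Set ℤ) : Set (ℕ × ℕ) :=
  {c | ∃ b ∈ A, c.1 ≤ {x | x ∈ A ∧ b < x}.ncard ∧ c.2 < {x | x ∉ A ∧ x < b}.ncard}

open Classical in
/-- The partition of an abacus (the empty one for sets of beads that are not abaci). -/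
noncomputable def partitionOfAbacus (A : Set ℤ) : YoungDiagram :=
  if h : (abacusCells A).Finite then
    { cells := h.toFinset
      isLowerSet := by
        rintro ⟨a, b⟩ ⟨c, d⟩ hle hab
        obtain ⟨h1, h2⟩ : c ≤ a ∧ d ≤ b := hle
        simp only [Set.Finite.coe_toFinset] at hab ⊢
        obtain ⟨x, hx, h3, h4⟩ := hab
        exact ⟨x, hx, h1.trans h3, h2.trans_lt h4⟩ }
  else ⊥

/-- Delete runner `c` (where `0 ≤ c < ℓ`) of an abacus with `ℓ` runners, renumbering the remaining
runners in order as `0, …, ℓ - 2` and keeping all levels: the entry of runner `i` on level `r` of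
the new abacus is the entry of runner `i` (if `i < c`) or `i + 1` (if `i ≥ c`) on level `r` of the
old one. -/
def removeRunner (ℓ : ℕ) (c : ℤ) (A : Set ℤ) : Set ℤ :=
  {y | (y / ((ℓ : ℤ) - 1)) * ℓ +
      (if y % ((ℓ : ℤ) - 1) < c then y % ((ℓ : ℤ) - 1) else y % ((ℓ : ℤ) - 1) + 1) ∈ A}

/-- The map `Φ_ℓ^k` on an `ℓ`-core `μ` with first part `k`: delete from an abacus of `μ` the runner
that contains the largest bead (here the bead `μ₁ - 1`). -/
noncomputable def Phi (ℓ : ℕ) (μ : YoungDiagram) : YoungDiagram :=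
  partitionOfAbacus (removeRunner ℓ (((μ.rowLen 0 : ℤ) - 1) % (ℓ : ℤ)) (abacus μ))

/-! ### The affine symmetric group

The coordinates of `ℝ^ℓ` are numbered `0, …, ℓ - 1` (like the runners of an abacus), by `ZMod ℓ`. -/

/-- The space `V` of vectors in `ℝ^ℓ` with coordinate sum zero. -/
def rootSpace (ℓ : ℕ) [NeZero ℓ] : Submodule ℝ (ZMod ℓ → ℝ) where
  carrier := {v | ∑ j, v j = 0}
  add_mem' := by
    intro a b ha hb
    simp only [Set.mem_ofPred_eq, Pi.add_apply, Finset.sum_add_distrib] at *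
    simp [ha, hb]
  zero_mem' := by simp
  smul_mem' := by
    intro c a ha
    simp only [Set.mem_ofPred_eq, Pi.smul_apply, smul_eq_mul, ← Finset.mul_sum] at *
    simp [ha]

/-- The reflection `s_i` on vectors.  For `i ≠ 0` it exchanges the coordinates `i - 1` and `i`; and
`s_0 (b_0, …, b_{ℓ-1}) = (b_{ℓ-1} + 1, b_1, …, b_{ℓ-2}, b_0 - 1)`. -/
def reflFun (ℓ : ℕ) (i : ZMod ℓ) (v : ZMod ℓ → ℝ) (j : ZMod ℓ) : ℝ :=
  v (Equiv.swap (i - 1) i j) +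
    if i = 0 then (if j = 0 then 1 else 0) - (if j = -1 then 1 else 0) else 0

theorem reflFun_mem (ℓ : ℕ) [NeZero ℓ] (i : ZMod ℓ) {v : ZMod ℓ → ℝ} (hv : v ∈ rootSpace ℓ) :
    reflFun ℓ i v ∈ rootSpace ℓ := by
  have hv' : ∑ j, v j = 0 := hv
  show ∑ j, reflFun ℓ i v j = 0
  have h1 : ∑ j, v (Equiv.swap (i - 1) i j) = 0 := by
    rw [Equiv.sum_comp (Equiv.swap (i - 1) i) v, hv']
  simp only [reflFun, Finset.sum_add_distrib, h1, zero_add]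
  split_ifs <;> simp

theorem reflFun_reflFun (ℓ : ℕ) (i : ZMod ℓ) (v : ZMod ℓ → ℝ) :
    reflFun ℓ i (reflFun ℓ i v) = v := by
  funext j
  simp only [reflFun, Equiv.swap_apply_self]
  by_cases hi : i = 0
  · subst hi
    simp only [zero_sub, if_true]
    by_cases h0 : j = 0
    · subst h0
      simp only [Equiv.swap_apply_right, Equiv.swap_apply_left]
      by_cases h : (-1 : ZMod ℓ) = 0 <;> by_cases h' : (0 : ZMod ℓ) = -1 <;> simp_all
    · by_cases h1 : j = -1
      · subst h1
        simp only [Equiv.swap_apply_right, Equiv.swap_apply_left]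
        by_cases h' : (0 : ZMod ℓ) = -1 <;> simp_all
      · rw [Equiv.swap_apply_of_ne_of_ne h1 h0]
        simp [h0, h1]
  · simp [hi]

/-- The reflection `s_i` as a bijection of `V`. -/
def reflV (ℓ : ℕ) [NeZero ℓ] (i : ZMod ℓ) : Equiv.Perm (rootSpace ℓ) where
  toFun v := ⟨reflFun ℓ i v, reflFun_mem ℓ i v.2⟩
  invFun v := ⟨reflFun ℓ i v, reflFun_mem ℓ i v.2⟩
  left_inv v := Subtype.ext (reflFun_reflFun ℓ i v)
  right_inv v := Subtype.ext (reflFun_reflFun ℓ i v)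

/-- The affine symmetric group: the group of bijections of `V` generated by `s_0, …, s_{ℓ-1}`. -/
def AffineSymmetricGroup (ℓ : ℕ) [NeZero ℓ] : Subgroup (Equiv.Perm (rootSpace ℓ)) :=
  Subgroup.closure (Set.range (reflV ℓ))

/-- The Coxeter generator `s_i` of the affine symmetric group. -/
def coxeterGen (ℓ : ℕ) [NeZero ℓ] (i : ZMod ℓ) : AffineSymmetricGroup ℓ :=
  ⟨reflV ℓ i, Subgroup.subset_closure ⟨i, rfl⟩⟩

/-- The element `s_{i₁} ⋯ s_{i_p}` expressed by the word `[i₁, …, i_p]`. -/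
def wordProd (ℓ : ℕ) [NeZero ℓ] (u : List (ZMod ℓ)) : AffineSymmetricGroup ℓ :=
  (u.map (coxeterGen ℓ)).prod

/-- The Coxeter length `l(w)`: the least length of a word that expresses `w`. -/
noncomputable def coxeterLength (ℓ : ℕ) [NeZero ℓ] (w : AffineSymmetricGroup ℓ) : ℕ :=
  sInf {n | ∃ u : List (ZMod ℓ), wordProd ℓ u = w ∧ u.length = n}

/-- `w` belongs to the parabolic quotient by the finite symmetric group, i.e. it is the
representative of minimal length of its left coset. -/
def IsMinimalCosetRep (ℓ : ℕ) [NeZero ℓ] (w : AffineSymmetricGroup ℓ) : Prop :=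
  ∀ i : ZMod ℓ, i ≠ 0 → coxeterLength ℓ w < coxeterLength ℓ (w * coxeterGen ℓ i)

/-- The flush abacus of a vector `b`: runner `i` is filled with beads down to level `b_i`. -/
def flushAbacus (ℓ : ℕ) (b : ZMod ℓ → ℝ) : Set ℤ :=
  {x | ((x / (ℓ : ℤ) : ℤ) : ℝ) ≤ b (x : ZMod ℓ)}

/-- The core `w(∅)`, which indexes the left coset of `w`: the partition of the balanced flush abacus
of the vector `w(0)` of the root lattice. -/
noncomputable def coreOf (ℓ : ℕ) [NeZero ℓ] (w : AffineSymmetricGroup ℓ) : YoungDiagram :=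
  partitionOfAbacus (flushAbacus ℓ ((w : Equiv.Perm (rootSpace ℓ)) 0 : rootSpace ℓ))

/-- `u` is a reduced word of the minimal length coset representative indexed by `μ`. -/
def IsReducedWordOf (ℓ : ℕ) [NeZero ℓ] (u : List (ZMod ℓ)) (μ : YoungDiagram) : Prop :=
  coxeterLength ℓ (wordProd ℓ u) = u.length ∧
    IsMinimalCosetRep ℓ (wordProd ℓ u) ∧ coreOf ℓ (wordProd ℓ u) = μ

/-- The minimal length coset representative `w(μ)` given by the canonical word. -/
noncomputable def canonicalElement (ℓ : ℕ) [NeZero ℓ] (μ : YoungDiagram) : AffineSymmetricGroup ℓ :=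
  wordProd ℓ (canonicalWord ℓ μ)

/-! ### The subexpression -/

/-- The core `s_{i_j} s_{i_{j+1}} ⋯ s_{i_{p-1}}(∅)`, where `[i_0, …, i_{p-1}]` is the
canonical word of `μ` (with positions numbered from `0`). -/
noncomputable def suffixCore (ℓ : ℕ) [NeZero ℓ] (μ : YoungDiagram) (j : ℕ) : YoungDiagram :=
  coreOf ℓ (wordProd ℓ ((canonicalWord ℓ μ).drop j))

/-- The set `J` of all positions `j` of the canonical word of `μ` such that the first row and the
last row of the core `s_{i_j} ⋯ s_{i_{p-1}}(∅)` are not equivalent. -/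
noncomputable def subexprIndices (ℓ : ℕ) [NeZero ℓ] (μ : YoungDiagram) : Finset ℕ :=
  (Finset.range (canonicalWord ℓ μ).length).filter fun j =>
    ¬ RowEquiv ℓ (suffixCore ℓ μ j) 0 (lastRow (suffixCore ℓ μ j))

/-- The residue modulo `ℓ - 1` of the box `c` of `μ` (in a row not equivalent to the first row) in
the diagram that is left when all rows equivalent to the first row of `μ` are deleted: its new row
index is the number of undeleted rows above it. -/
def relabel (ℓ : ℕ) (μ : YoungDiagram) (c : ℕ × ℕ) : ZMod (ℓ - 1) :=
  residue (ℓ - 1) (((Finset.range c.1).filter fun p => ¬ RowEquiv ℓ μ p 0).card, c.2)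

/-- The subexpression of the canonical word of `μ` at the positions `j ∈ J`, in increasing order of
`j`, with residues relabelled: the letter at position `j` is the residue modulo `ℓ` of the last box
of the core `s_{i_j} ⋯ s_{i_{p-1}}(∅)`, and is replaced by the new label of the same box. -/
noncomputable def relabelledSubword (ℓ : ℕ) [NeZero ℓ] (μ : YoungDiagram) : List (ZMod (ℓ - 1)) :=
  ((subexprIndices ℓ μ).sort (· ≤ ·)).map fun j => relabel ℓ μ (lastBox (suffixCore ℓ μ j))

/-!
An `ℓ`-core is studied through its abacus, the set of the beads `μ_p - p - 1` (rows `p ≥ 0`); its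
complement consists of the gaps `q - μ'_q` (columns `q ≥ 0`), and the hook length of a box is the
difference of the bead of its row and the gap of its column.  Hence `μ` is an `ℓ`-core iff its
abacus is closed under `x ↦ x - ℓ`, that is, flush (`isCore_iff`).

*Reduced words.* On positions of the abacus the generator `s_i` exchanges each position of runner
`i - 1` with the next one (`runnerSwap`); this describes both its action on vectors
(`flushAbacus_reflFun`) and the step `μ ↦ removeResidue i μ` of the canonical word
(`abacus_removeResidue`).  The latter holds because no nonempty row ends in residue `i - 1` when the
bottom row ends in residue `i` (`bead_ne_sub_one`).  So the canonical word of `μ` leads from the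
empty core to `μ`.  A statistic on flush abaci, the number of pairs of a first gap of a runner and a
bead after it (`abacusInversions`), grows by at most one under each generator, and by exactly one
in each step of a canonical word.  Therefore no element of the coset has a shorter expression, and
the word is reduced.  As the parity of the length is an invariant (the linear part of a generator
is a transposition), right multiplication by `s_i`, `i ≠ 0`, which stays in the coset, must increase
the length: the element is the minimal representative.

*The map `Φ`.* No gap on the runner of the largest bead comes before that bead, so deleting the
runner amounts to deleting the rows equivalent to the first row, without changing the other rows
(`mem_Phi`, `rowLen_Phi`).  A bead at `x` is moved to `x - ⌊(x - b) / ℓ⌋`, where `b` is the largest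
bead (`bead_Phi`), so `Φ μ` is flush with respect to `ℓ - 1`, and two remaining rows are equivalent
modulo `ℓ` iff they are equivalent modulo `ℓ - 1` after the deletion (`intCast_eq_iff_deleted`).

*The subword.* Removing the boxes of residue `i` does not change which of the nonempty rows are
equivalent (`runner_removeResidue_eq_iff`), so labels can be computed in any of the intermediate
cores.  If the first and the last row of `μ` are equivalent, the step changes only deleted rows: `Φ`
stays the same and the first row loses one box.  Otherwise the first row keeps its length and the
step becomes a step of the canonical word of `Φ μ` (`removeResidue_Phi`).  Induction along the
canonical word gives the subword and the difference `k` of the lengths.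
-/

/-! ### Beads and gaps of the abacus of a diagram -/

/-- The bead of row `p` in the abacus of `μ`.  Its class modulo `ℓ` is the runner on which it lies;
for a nonempty row this is also the residue of the rightmost box of the row. -/
def bead (μ : YoungDiagram) (p : ℕ) : ℤ := (μ.rowLen p : ℤ) - (p + 1)

/-- The gap of column `q` in the abacus of `μ`. -/
def gap (μ : YoungDiagram) (q : ℕ) : ℤ := (q : ℤ) - μ.colLen q

theorem bead_strictAnti (μ : YoungDiagram) : StrictAnti (bead μ) := by
  intro p q h
  have := μ.rowLen_anti p q h.le
  simp only [bead]
  omega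

theorem gap_strictMono (μ : YoungDiagram) : StrictMono (gap μ) := by
  intro p q h
  have := μ.colLen_anti p q h.le
  simp only [gap]
  omega

theorem mem_iff_gap_lt_bead {μ : YoungDiagram} {p q : ℕ} : (p, q) ∈ μ ↔ gap μ q < bead μ p := by
  have h1 := @YoungDiagram.mem_iff_lt_rowLen μ p q
  have h2 := @YoungDiagram.mem_iff_lt_colLen μ p q
  simp only [bead, gap]
  by_cases h : (p, q) ∈ μ
  · have := h1.1 h
    have := h2.1 h
    simp only [h, true_iff]
    omega
  · have h1' := mt h1.2 h
    have h2' := mt h2.2 h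
    simp only [h, false_iff]
    omega

theorem bead_ne_gap (μ : YoungDiagram) (p q : ℕ) : bead μ p ≠ gap μ q := by
  have h1 := @YoungDiagram.mem_iff_lt_rowLen μ p q
  have h2 := @YoungDiagram.mem_iff_lt_colLen μ p q
  simp only [bead, gap]
  by_cases h : (p, q) ∈ μ
  · have := h1.1 h
    have := h2.1 h
    omega
  · have h1' := mt h1.2 h
    have h2' := mt h2.2 h
    omega

theorem mem_abacus_iff {μ : YoungDiagram} {x : ℤ} : x ∈ abacus μ ↔ ∃ p, bead μ p = x :=
  exists_congr fun _ => eq_comm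

theorem bead_mem_abacus (μ : YoungDiagram) (p : ℕ) : bead μ p ∈ abacus μ := ⟨p, rfl⟩

theorem notMem_abacus_iff {μ : YoungDiagram} {x : ℤ} : x ∉ abacus μ ↔ ∃ q, gap μ q = x := by
  constructor
  · intro hx
    have hex : ∃ p, bead μ p ≤ x := by
      refine ⟨(μ.rowLen 0 - x).toNat, ?_⟩
      have := μ.rowLen_anti 0 (μ.rowLen 0 - x).toNat (Nat.zero_le _)
      simp only [bead]
      omega
    classical
    -- with `p` beads above `x`, the gap `x` belongs to column `x + p`
    obtain ⟨p, hp, hmin⟩ : ∃ p, bead μ p ≤ x ∧ ∀ r < p, ¬ bead μ r ≤ x :=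
      ⟨Nat.find hex, Nat.find_spec hex, fun r hr => Nat.find_min hex hr⟩
    have hne : bead μ p ≠ x := fun h => hx (h ▸ bead_mem_abacus μ p)
    have hp' : (μ.rowLen p : ℤ) ≤ x + p := by
      simp only [bead] at hp hne
      omega
    obtain ⟨q, hq⟩ : ∃ q : ℕ, (q : ℤ) = x + p := ⟨(x + p).toNat, by omega⟩
    refine ⟨q, ?_⟩
    have h1 : ¬ p < μ.colLen q := by
      rw [← YoungDiagram.mem_iff_lt_colLen, YoungDiagram.mem_iff_lt_rowLen]
      omega
    have h2 : p ≤ μ.colLen q := by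
      rcases Nat.eq_zero_or_pos p with rfl | h0
      · exact Nat.zero_le _
      · have h3 := hmin (p - 1) (by omega)
        have h4 : (p - 1, q) ∈ μ := by
          rw [YoungDiagram.mem_iff_lt_rowLen]
          simp only [bead] at h3
          omega
        have := YoungDiagram.mem_iff_lt_colLen.1 h4
        omega
    simp only [gap]
    omega
  · rintro ⟨q, rfl⟩ h
    obtain ⟨p, hp⟩ := mem_abacus_iff.1 h
    exact bead_ne_gap μ p q hp

theorem hookLength_eq {μ : YoungDiagram} {p q : ℕ} (h : (p, q) ∈ μ) :
    (hookLength μ (p, q) : ℤ) = bead μ p - gap μ q := by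
  have h1 := YoungDiagram.mem_iff_lt_rowLen.1 h
  have h2 := YoungDiagram.mem_iff_lt_colLen.1 h
  simp only [hookLength, bead, gap]
  omega

/-- In a flush abacus, every position before a bead on the same runner is occupied. -/
theorem mem_of_flush {ℓ : ℕ} (hℓ : 0 < ℓ) {A : Set ℤ} (hA : ∀ x ∈ A, x - ℓ ∈ A) {x y : ℤ}
    (hx : x ∈ A) (hyx : y ≤ x) (hd : (x : ZMod ℓ) = y) : y ∈ A := by
  obtain ⟨m, hm⟩ := (ZMod.intCast_eq_intCast_iff_dvd_sub y x ℓ).1 hd.symm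
  have hm0 : 0 ≤ m := by
    by_contra hneg
    have : (ℓ : ℤ) * m < 0 := mul_neg_of_pos_of_neg (by exact_mod_cast hℓ) (by omega)
    omega
  obtain ⟨m, rfl⟩ := Int.eq_ofNat_of_zero_le hm0
  have hk : ∀ m : ℕ, x - ℓ * m ∈ A := by
    intro m
    induction m with
    | zero => simpa using hx
    | succ m ih => convert hA _ ih using 1; push_cast; ring
  convert hk m using 1
  linarith

/-- A core is a diagram whose abacus is flush: no bead has a gap before it on the same runner. -/
theorem isCore_iff {ℓ : ℕ} (hℓ : 0 < ℓ) {μ : YoungDiagram} :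
    IsCore ℓ μ ↔ ∀ x ∈ abacus μ, x - ℓ ∈ abacus μ := by
  constructor
  · intro h x hx
    by_contra hx'
    obtain ⟨p, rfl⟩ := mem_abacus_iff.1 hx
    obtain ⟨q, hq⟩ := notMem_abacus_iff.1 hx'
    have hm : (p, q) ∈ μ := mem_iff_gap_lt_bead.2 (by omega)
    have := hookLength_eq hm
    refine h _ hm ⟨1, ?_⟩
    omega
  · rintro h ⟨p, q⟩ hm ⟨m, hd⟩
    have := hookLength_eq hm
    refine notMem_abacus_iff.2 ⟨q, rfl⟩ (mem_of_flush hℓ h (bead_mem_abacus μ p) (by omega) ?_)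
    rw [eq_comm, ZMod.intCast_eq_intCast_iff_dvd_sub, ← this, hd]
    exact ⟨m, by push_cast; rfl⟩

theorem IsCore.mem_abacus {ℓ : ℕ} (hℓ : 0 < ℓ) {μ : YoungDiagram} (h : IsCore ℓ μ) {x y : ℤ}
    (hx : x ∈ abacus μ) (hyx : y ≤ x) (hd : (x : ZMod ℓ) = y) : y ∈ abacus μ :=
  mem_of_flush hℓ ((isCore_iff hℓ).1 h) hx hyx hd

theorem rowLen_pos_iff {μ : YoungDiagram} {p : ℕ} : 0 < μ.rowLen p ↔ p < μ.colLen 0 := by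
  rw [← YoungDiagram.mem_iff_lt_rowLen, YoungDiagram.mem_iff_lt_colLen]

theorem rowLen_bot (p : ℕ) : (⊥ : YoungDiagram).rowLen p = 0 := by
  by_contra h
  exact YoungDiagram.notMem_bot _ (YoungDiagram.mem_iff_lt_rowLen.2 (Nat.pos_of_ne_zero h))

theorem ext_rowLen {μ ν : YoungDiagram} (h : ∀ p, μ.rowLen p = ν.rowLen p) : μ = ν := by
  ext ⟨p, q⟩
  simp only [YoungDiagram.mem_cells, YoungDiagram.mem_iff_lt_rowLen, h]

theorem colLen_pos {μ : YoungDiagram} (h : μ ≠ ⊥) : 0 < μ.colLen 0 := by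
  have := YoungDiagram.mem_iff_lt_colLen.1 (μ.up_left_mem le_rfl (Nat.zero_le _)
    (lastBox_isRemovable h).1)
  omega

theorem rowLen_lastRow_pos {μ : YoungDiagram} (h : μ ≠ ⊥) : 0 < μ.rowLen (lastRow μ) := by
  rw [rowLen_pos_iff, lastRow]
  have := colLen_pos h
  omega

theorem residue_rowEnd {ℓ : ℕ} {μ : YoungDiagram} {p : ℕ} (h : 0 < μ.rowLen p) :
    residue ℓ (rowEnd μ p) = (bead μ p : ZMod ℓ) := by
  obtain ⟨n, hn⟩ : ∃ n, μ.rowLen p = n + 1 := ⟨μ.rowLen p - 1, by omega⟩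
  simp only [residue, rowEnd, bead, hn]
  push_cast
  simp

theorem rowEquiv_iff {ℓ : ℕ} {μ : YoungDiagram} {p q : ℕ} (hp : 0 < μ.rowLen p)
    (hq : 0 < μ.rowLen q) :
    RowEquiv ℓ μ p q ↔ (bead μ p : ZMod ℓ) = bead μ q := by
  rw [RowEquiv, residue_rowEnd hp, residue_rowEnd hq]

/-! ### The partition of an abacus -/

theorem mem_partitionOfAbacus {A : Set ℤ} (h : (abacusCells A).Finite) {c : ℕ × ℕ} :
    c ∈ partitionOfAbacus A ↔ c ∈ abacusCells A := by
  rw [← YoungDiagram.mem_cells, partitionOfAbacus, dif_pos h]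
  simp

open Classical in
/-- Restrict the abacus of `μ` to the range of a strictly monotone map.  If no gap outside the range
lies before a bead in the range, then the resulting partition consists of the rows of `μ` whose
beads lie in the range. -/
theorem mem_partitionOfAbacus_preimage {μ : YoungDiagram} {φ : ℤ → ℤ} (hφ : StrictMono φ)
    (hgap : ∀ p q, bead μ p ∈ Set.range φ → gap μ q < bead μ p → gap μ q ∈ Set.range φ)
    {r c : ℕ} :
    (r, c) ∈ partitionOfAbacus (φ ⁻¹' abacus μ) ↔
      ∃ p, bead μ p ∈ Set.range φ ∧ r ≤ Nat.count (fun s => bead μ s ∈ Set.range φ) p ∧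
        c < μ.rowLen p := by
  have key : ∀ b p, φ b = bead μ p →
      {x | x ∈ φ ⁻¹' abacus μ ∧ b < x}.ncard = Nat.count (fun s => bead μ s ∈ Set.range φ) p ∧
      {x | x ∉ φ ⁻¹' abacus μ ∧ x < b}.ncard = μ.rowLen p := by
    intro b p hb
    constructor
    · rw [Nat.count_eq_card_filter_range, ← Set.ncard_image_of_injective _ hφ.injective,
        ← Set.ncard_coe_finset, ← Set.ncard_image_of_injective _ (bead_strictAnti μ).injective]
      congr 1
      ext x
      simp only [Set.mem_image, Set.mem_preimage, Set.mem_ofPred_eq, Finset.coe_filter,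
        Finset.mem_range]
      constructor
      · rintro ⟨y, ⟨hy, hby⟩, rfl⟩
        obtain ⟨s, hs⟩ := mem_abacus_iff.1 hy
        refine ⟨s, ⟨?_, y, hs.symm⟩, hs⟩
        rw [← (bead_strictAnti μ).lt_iff_gt, ← hb, hs]
        exact hφ hby
      · rintro ⟨s, ⟨hsp, y, hy⟩, rfl⟩
        refine ⟨y, ⟨?_, ?_⟩, hy⟩
        · rw [hy]; exact bead_mem_abacus μ s
        · rw [← hφ.lt_iff_lt, hy, hb]
          exact bead_strictAnti μ hsp
    · rw [← Set.ncard_image_of_injective _ hφ.injective]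
      have : φ '' {x | x ∉ φ ⁻¹' abacus μ ∧ x < b} = gap μ '' (Finset.range (μ.rowLen p)) := by
        ext x
        simp only [Set.mem_image, Set.mem_preimage, Set.mem_ofPred_eq, Finset.coe_range,
          Set.mem_Iio]
        constructor
        · rintro ⟨y, ⟨hy, hyb⟩, rfl⟩
          obtain ⟨q, hq⟩ := notMem_abacus_iff.1 hy
          refine ⟨q, ?_, hq⟩
          rw [← YoungDiagram.mem_iff_lt_rowLen, mem_iff_gap_lt_bead, hq, ← hb]
          exact hφ hyb
        · rintro ⟨q, hq, rfl⟩
          rw [← YoungDiagram.mem_iff_lt_rowLen, mem_iff_gap_lt_bead] at hq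
          obtain ⟨y, hy⟩ := hgap p q ⟨b, hb⟩ hq
          refine ⟨y, ⟨?_, ?_⟩, hy⟩
          · rw [hy, notMem_abacus_iff]; exact ⟨q, rfl⟩
          · rw [← hφ.lt_iff_lt, hy, hb]; exact hq
      rw [this, Set.ncard_image_of_injective _ (gap_strictMono μ).injective,
        Set.ncard_coe_finset, Finset.card_range]
  have hcells : ∀ r c, (r, c) ∈ abacusCells (φ ⁻¹' abacus μ) ↔
      ∃ p, bead μ p ∈ Set.range φ ∧ r ≤ Nat.count (fun s => bead μ s ∈ Set.range φ) p ∧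
        c < μ.rowLen p := by
    intro r c
    constructor
    · rintro ⟨b, hb, h1, h2⟩
      obtain ⟨p, hp⟩ := mem_abacus_iff.1 hb
      obtain ⟨h3, h4⟩ := key b p hp.symm
      exact ⟨p, ⟨b, hp.symm⟩, h3 ▸ h1, h4 ▸ h2⟩
    · rintro ⟨p, ⟨b, hb⟩, h1, h2⟩
      obtain ⟨h3, h4⟩ := key b p hb
      exact ⟨b, mem_abacus_iff.2 ⟨p, hb.symm⟩, h3.symm ▸ h1, h4.symm ▸ h2⟩
  rw [mem_partitionOfAbacus, hcells]
  refine μ.cells.finite_toSet.subset ?_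
  rintro ⟨r, c⟩ hrc
  obtain ⟨p, -, h1, h2⟩ := (hcells r c).1 hrc
  exact μ.up_left_mem (h1.trans (Nat.count_le _)) le_rfl (YoungDiagram.mem_iff_lt_rowLen.2 h2)

theorem partitionOfAbacus_translate (μ : YoungDiagram) (t : ℤ) :
    partitionOfAbacus ((fun x => x - t) ⁻¹' abacus μ) = μ := by
  have hs : ∀ x : ℤ, x ∈ Set.range (fun x : ℤ => x - t) := fun x => ⟨x + t, by simp⟩
  ext ⟨r, c⟩
  rw [YoungDiagram.mem_cells, mem_partitionOfAbacus_preimage (fun x y h => by simpa using h)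
    (fun _ _ _ _ => hs _), YoungDiagram.mem_cells]
  simp only [hs, true_and, Nat.count_true]
  constructor
  · rintro ⟨p, h1, h2⟩
    exact μ.up_left_mem h1 le_rfl (YoungDiagram.mem_iff_lt_rowLen.2 h2)
  · intro h
    exact ⟨r, le_rfl, YoungDiagram.mem_iff_lt_rowLen.1 h⟩

/-! ### Deleting the runner of the largest bead -/

/-- The number of rows before row `p` whose beads do not lie on the runner of the first bead. -/
def keptRows (ℓ : ℕ) (μ : YoungDiagram) (p : ℕ) : ℕ :=
  Nat.count (fun s => (bead μ s : ZMod ℓ) ≠ bead μ 0) p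

/-- The position on an abacus with `ℓ` runners of the entry that has position `y` after runner `c`
has been deleted. -/
def insertRunner (ℓ : ℕ) (c y : ℤ) : ℤ :=
  (y / ((ℓ : ℤ) - 1)) * ℓ +
      (if y % ((ℓ : ℤ) - 1) < c then y % ((ℓ : ℤ) - 1) else y % ((ℓ : ℤ) - 1) + 1)

theorem insertRunner_strictMono {ℓ : ℕ} (hℓ : 2 ≤ ℓ) (c : ℤ) : StrictMono (insertRunner ℓ c) := by
  intro x y h
  have hn : (0 : ℤ) < (ℓ : ℤ) - 1 := by omega
  have hx := Int.mul_ediv_add_emod x ((ℓ : ℤ) - 1)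
  have hy := Int.mul_ediv_add_emod y ((ℓ : ℤ) - 1)
  have hx0 := Int.emod_nonneg x hn.ne'
  have hy0 := Int.emod_nonneg y hn.ne'
  have hx1 := Int.emod_lt_of_pos x hn
  have hy1 := Int.emod_lt_of_pos y hn
  have hq : x / ((ℓ : ℤ) - 1) ≤ y / ((ℓ : ℤ) - 1) := Int.ediv_le_ediv hn h.le
  simp only [insertRunner]
  rcases hq.eq_or_lt with hq | hq
  · rw [hq] at hx ⊢
    split_ifs <;> omega
  · have : (x / ((ℓ : ℤ) - 1) + 1) * ℓ ≤ (y / ((ℓ : ℤ) - 1)) * ℓ :=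
      mul_le_mul_of_nonneg_right hq (by omega)
    rw [add_mul] at this
    split_ifs <;> omega

theorem mem_range_insertRunner {ℓ : ℕ} (hℓ : 2 ≤ ℓ) {c x : ℤ} (hc : 0 ≤ c) (hcℓ : c < ℓ) :
    x ∈ Set.range (insertRunner ℓ c) ↔ x % ℓ ≠ c := by
  have hn : (0 : ℤ) < (ℓ : ℤ) - 1 := by omega
  have hl : (0 : ℤ) < ℓ := by omega
  constructor
  · rintro ⟨y, rfl⟩
    have hy0 := Int.emod_nonneg y hn.ne'
    have hy1 := Int.emod_lt_of_pos y hn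
    simp only [insertRunner]
    rw [add_comm, Int.add_mul_emod_self_right]
    split_ifs with h
    · rw [Int.emod_eq_of_lt hy0 (by omega)]; exact h.ne
    · rw [Int.emod_eq_of_lt (by omega) (by omega)]; omega
  · intro hx
    have h0 := Int.emod_nonneg x hl.ne'
    have h1 := Int.emod_lt_of_pos x hl
    have h2 := Int.mul_ediv_add_emod x (ℓ : ℤ)
    have hval : ∀ q r : ℤ, 0 ≤ r → r < (ℓ : ℤ) - 1 → insertRunner ℓ c (q * ((ℓ : ℤ) - 1) + r) =
        q * ℓ + if r < c then r else r + 1 := by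
      intro q r hr0 hr1
      have e1 : (q * ((ℓ : ℤ) - 1) + r) / ((ℓ : ℤ) - 1) = q := by
        rw [add_comm, Int.add_mul_ediv_right _ _ hn.ne', Int.ediv_eq_zero_of_lt hr0 hr1, zero_add]
      have e2 : (q * ((ℓ : ℤ) - 1) + r) % ((ℓ : ℤ) - 1) = r := by
        rw [add_comm, Int.add_mul_emod_self_right, Int.emod_eq_of_lt hr0 hr1]
      rw [insertRunner, e1, e2]
    rcases lt_or_gt_of_ne hx with h | h
    · refine ⟨x / ℓ * ((ℓ : ℤ) - 1) + x % ℓ, ?_⟩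
      rw [hval _ _ h0 (by omega), if_pos h, mul_comm]
      exact h2
    · refine ⟨x / ℓ * ((ℓ : ℤ) - 1) + (x % ℓ - 1), ?_⟩
      rw [hval _ _ (by omega) (by omega), if_neg (by omega), mul_comm]
      linarith

section Phi

variable {ℓ : ℕ} {μ : YoungDiagram}

theorem keptRows_lt {p q : ℕ} (h : p < q) (hp : (bead μ p : ZMod ℓ) ≠ bead μ 0) :
    keptRows ℓ μ p < keptRows ℓ μ q :=
  Nat.count_strict_mono hp h

theorem le_of_keptRows_le {p q : ℕ} (hq : (bead μ q : ZMod ℓ) ≠ bead μ 0)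
    (h : keptRows ℓ μ p ≤ keptRows ℓ μ q) : p ≤ q := by
  by_contra hlt
  exact absurd h (not_le.2 (keptRows_lt (not_le.1 hlt) hq))

theorem exists_keptRows_eq (hℓ : 2 ≤ ℓ) (r : ℕ) :
    ∃ p, (bead μ p : ZMod ℓ) ≠ bead μ 0 ∧ keptRows ℓ μ p = r := by
  have hinf : (Set.ofPred fun s => (bead μ s : ZMod ℓ) ≠ bead μ 0).Infinite := by
    refine Set.infinite_of_forall_exists_gt fun N => ?_
    -- the beads of two consecutive empty rows lie on different runners
    by_contra! hcon
    set s := N + 1 + μ.colLen 0 with hs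
    have h1 : (bead μ s : ZMod ℓ) = bead μ 0 := by
      by_contra h
      have := hcon s h
      omega
    have h2 : (bead μ (s + 1) : ZMod ℓ) = bead μ 0 := by
      by_contra h
      have := hcon (s + 1) h
      omega
    have e1 : μ.rowLen s = 0 := by
      have := mt (rowLen_pos_iff (μ := μ) (p := s)).1
      omega
    have e2 : μ.rowLen (s + 1) = 0 := by
      have := mt (rowLen_pos_iff (μ := μ) (p := s + 1)).1
      omega
    have h3 := (ZMod.intCast_eq_intCast_iff_dvd_sub _ _ _).1 (h2.trans h1.symm)
    simp only [bead, e1, e2] at h3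
    have := Int.le_of_dvd (by omega) h3
    omega
  exact ⟨Nat.nth _ r, Nat.nth_mem_of_infinite hinf r, Nat.count_nth_of_infinite hinf r⟩

/-- `Φ` deletes the rows equivalent to the first row: no gap of the deleted runner lies before the
largest bead, so the lengths of the other rows do not change. -/
theorem mem_Phi (hℓ : 2 ≤ ℓ) (hμ : IsCore ℓ μ) {r c : ℕ} :
    (r, c) ∈ Phi ℓ μ ↔
      ∃ p, (bead μ p : ZMod ℓ) ≠ bead μ 0 ∧ r ≤ keptRows ℓ μ p ∧ c < μ.rowLen p := by
  have hl : (0 : ℤ) < ℓ := by omega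
  have h0 : bead μ 0 = (μ.rowLen 0 : ℤ) - 1 := by simp [bead]
  have hr : ∀ x, x ∈ Set.range (insertRunner ℓ (((μ.rowLen 0 : ℤ) - 1) % (ℓ : ℤ))) ↔
      (x : ZMod ℓ) ≠ bead μ 0 := by
    intro x
    rw [mem_range_insertRunner hℓ (Int.emod_nonneg _ hl.ne') (Int.emod_lt_of_pos _ hl), ← h0, Ne,
      Ne, ZMod.intCast_eq_intCast_iff']
  have := mem_partitionOfAbacus_preimage (μ := μ) (r := r) (c := c)
    (insertRunner_strictMono hℓ (((μ.rowLen 0 : ℤ) - 1) % (ℓ : ℤ))) (by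
      intro p q _ hlt
      rw [hr]
      intro heq
      refine notMem_abacus_iff.2 ⟨q, rfl⟩ (hμ.mem_abacus (by omega) (bead_mem_abacus μ 0) ?_
        heq.symm)
      exact hlt.le.trans ((bead_strictAnti μ).antitone (Nat.zero_le p)))
  simp only [hr] at this
  refine this.trans ?_
  simp only [keptRows]

theorem rowLen_Phi (hℓ : 2 ≤ ℓ) (hμ : IsCore ℓ μ) {p : ℕ}
    (hp : (bead μ p : ZMod ℓ) ≠ bead μ 0) : (Phi ℓ μ).rowLen (keptRows ℓ μ p) = μ.rowLen p := by
  have : ∀ c, c < (Phi ℓ μ).rowLen (keptRows ℓ μ p) ↔ c < μ.rowLen p := by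
    intro c
    rw [← YoungDiagram.mem_iff_lt_rowLen, mem_Phi hℓ hμ]
    constructor
    · rintro ⟨q, hq, h1, h2⟩
      exact h2.trans_le (μ.rowLen_anti _ _ (le_of_keptRows_le hq h1))
    · intro h
      exact ⟨p, hp, le_rfl, h⟩
  exact le_antisymm (not_lt.1 fun h => lt_irrefl _ ((this _).1 h))
    (not_lt.1 fun h => lt_irrefl _ ((this _).2 h))

theorem rowLen_Phi_zero_le (hℓ : 2 ≤ ℓ) (hμ : IsCore ℓ μ) :
    (Phi ℓ μ).rowLen 0 ≤ μ.rowLen 0 := by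
  obtain ⟨p, hp, h⟩ := exists_keptRows_eq (μ := μ) hℓ 0
  have h1 := rowLen_Phi hℓ hμ hp
  rw [h] at h1
  rw [h1]
  exact μ.rowLen_anti _ _ (Nat.zero_le _)

/-- The beads on the runner of the first bead `b` occupy the positions `b, b - ℓ, b - 2ℓ, …`, so
their number after a position `x` is the negative of the floor of `(x - b) / ℓ`. -/
theorem keptRows_eq (hℓ : 2 ≤ ℓ) (hμ : IsCore ℓ μ) (p : ℕ) :
    (keptRows ℓ μ p : ℤ) = p + (bead μ p - bead μ 0) / ℓ := by
  have hl : (0 : ℤ) < ℓ := by omega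
  set b := bead μ 0 with hb
  set N := (-((bead μ p - b) / ℓ)).toNat with hN
  have hle : bead μ p ≤ b := (bead_strictAnti μ).antitone (Nat.zero_le p)
  have hdiv : (bead μ p - b) / ℓ ≤ 0 := by
    have := Int.ediv_le_ediv hl (show bead μ p - b ≤ 0 by omega)
    simpa using this
  have hlt : ∀ j : ℕ, bead μ p < b - ℓ * j ↔ j < N := by
    intro j
    have h1 : j < N ↔ (bead μ p - b) / ℓ < -(j : ℤ) := by omega
    rw [h1, Int.ediv_lt_iff_lt_mul hl]
    constructor <;> intro h <;> linarith
  have hcount : ((Finset.range p).filter fun s => ¬ (bead μ s : ZMod ℓ) ≠ b).card = N := by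
    rw [← Finset.card_range N, ← Finset.card_image_of_injective _ (bead_strictAnti μ).injective,
      ← Finset.card_image_of_injective (Finset.range N) (f := fun j : ℕ => b - ℓ * (j : ℤ))
        (fun i j h => by simpa [show ℓ ≠ 0 by omega] using h)]
    congr 1
    ext x
    simp only [Finset.mem_image, Finset.mem_filter, Finset.mem_range, not_not]
    constructor
    · rintro ⟨s, ⟨hsp, hs⟩, rfl⟩
      obtain ⟨m, hm⟩ := (ZMod.intCast_eq_intCast_iff_dvd_sub _ _ _).1 hs
      have h1 : bead μ s ≤ b := (bead_strictAnti μ).antitone (Nat.zero_le s)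
      have h2 := bead_strictAnti μ hsp
      have hm0 : 0 ≤ m := by
        by_contra hneg
        have : (ℓ : ℤ) * m < 0 := mul_neg_of_pos_of_neg hl (by omega)
        omega
      obtain ⟨m, rfl⟩ := Int.eq_ofNat_of_zero_le hm0
      exact ⟨m, (hlt m).1 (by linarith), by linarith⟩
    · rintro ⟨j, hj, rfl⟩
      have hj' := (hlt j).2 hj
      have hz : ((b : ℤ) : ZMod ℓ) = ((b - ℓ * j : ℤ) : ZMod ℓ) := by
        simp
      obtain ⟨s, hs⟩ := mem_abacus_iff.1 (hμ.mem_abacus (by omega) (bead_mem_abacus μ 0)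
        (y := b - ℓ * j) (by have : (0 : ℤ) ≤ ℓ * j := by positivity
                             omega) hz)
      refine ⟨s, ⟨?_, ?_⟩, hs⟩
      · rw [← (bead_strictAnti μ).lt_iff_gt, hs]; exact hj'
      · rw [hs]; exact hz.symm
  have hsum := Finset.card_filter_add_card_filter_not (s := Finset.range p)
    (fun s => (bead μ s : ZMod ℓ) ≠ b)
  rw [hcount, Finset.card_range, ← Nat.count_eq_card_filter_range] at hsum
  have : keptRows ℓ μ p + N = p := hsum
  omega

/-- The position of a bead after the runner of the first bead is deleted. -/
theorem bead_Phi (hℓ : 2 ≤ ℓ) (hμ : IsCore ℓ μ) {p : ℕ} (hp : (bead μ p : ZMod ℓ) ≠ bead μ 0) :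
    bead (Phi ℓ μ) (keptRows ℓ μ p) = bead μ p - (bead μ p - bead μ 0) / ℓ := by
  have h1 := keptRows_eq hℓ hμ p
  have h2 := rowLen_Phi hℓ hμ hp
  rw [bead, h2, h1, bead]
  ring

/-- Two positions off the deleted runner, that of `b`, lie on the same runner iff they do so after the
deletion. -/
theorem intCast_eq_iff_deleted (hℓ : 2 ≤ ℓ) {b x y : ℤ} (hx : (x : ZMod ℓ) ≠ b)
    (hy : (y : ZMod ℓ) ≠ b) :
    ((x - (x - b) / ℓ : ℤ) : ZMod (ℓ - 1)) = ((y - (y - b) / ℓ : ℤ) : ZMod (ℓ - 1)) ↔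
      (x : ZMod ℓ) = y := by
  have hl : (0 : ℤ) < ℓ := by omega
  have hn : (((ℓ - 1 : ℕ)) : ℤ) = (ℓ : ℤ) - 1 := by omega
  -- with `x - b = ℓ q + s`, the new position is `b + (ℓ - 1) q + s`, where `1 ≤ s ≤ ℓ - 1`
  have hpos : ∀ z : ℤ, (z : ZMod ℓ) ≠ b → 0 < (z - b) % ℓ := by
    intro z hz
    refine lt_of_le_of_ne (Int.emod_nonneg _ hl.ne') fun h => hz ?_
    rw [eq_comm, ZMod.intCast_eq_intCast_iff_dvd_sub]
    exact Int.dvd_of_emod_eq_zero h.symm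
  have hx0 := hpos x hx
  have hy0 := hpos y hy
  have hx1 := Int.emod_lt_of_pos (x - b) hl
  have hy1 := Int.emod_lt_of_pos (y - b) hl
  have hxe := Int.mul_ediv_add_emod (x - b) ℓ
  have hye := Int.mul_ediv_add_emod (y - b) ℓ
  rw [ZMod.intCast_eq_intCast_iff_dvd_sub, ZMod.intCast_eq_intCast_iff_dvd_sub, hn]
  generalize (x - b) / (ℓ : ℤ) = q at *
  generalize (y - b) / (ℓ : ℤ) = q' at *
  generalize (x - b) % (ℓ : ℤ) = s at *
  generalize (y - b) % (ℓ : ℤ) = s' at *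
  constructor
  · intro h
    have h' : (ℓ : ℤ) - 1 ∣ s' - s := by
      have : s' - s = (y - q' - (x - q)) - ((ℓ : ℤ) - 1) * (q' - q) := by linarith
      rw [this]
      exact dvd_sub h (Dvd.intro _ rfl)
    have : s' - s = 0 := Int.eq_zero_of_abs_lt_dvd h' (by rw [abs_lt]; constructor <;> omega)
    exact ⟨q' - q, by linarith⟩
  · intro h
    have h' : (ℓ : ℤ) ∣ s' - s := by
      have : s' - s = (y - x) - (ℓ : ℤ) * (q' - q) := by linarith
      rw [this]
      exact dvd_sub h (Dvd.intro _ rfl)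
    have : s' - s = 0 := Int.eq_zero_of_abs_lt_dvd h' (by rw [abs_lt]; constructor <;> omega)
    exact ⟨q' - q, by linarith⟩

theorem isCore_Phi (hℓ : 2 ≤ ℓ) (hμ : IsCore ℓ μ) : IsCore (ℓ - 1) (Phi ℓ μ) := by
  have hl : (ℓ : ℤ) ≠ 0 := by omega
  rw [isCore_iff (by omega)]
  intro x hx
  obtain ⟨r, rfl⟩ := mem_abacus_iff.1 hx
  obtain ⟨p, hp, rfl⟩ := exists_keptRows_eq (μ := μ) hℓ r
  obtain ⟨q, hq⟩ := mem_abacus_iff.1 ((isCore_iff (by omega)).1 hμ _ (bead_mem_abacus μ p))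
  have hq0 : (bead μ q : ZMod ℓ) ≠ bead μ 0 := by
    rw [hq]
    simpa using hp
  refine mem_abacus_iff.2 ⟨keptRows ℓ μ q, ?_⟩
  rw [bead_Phi hℓ hμ hp, bead_Phi hℓ hμ hq0, hq,
    show bead μ p - (ℓ : ℤ) - bead μ 0 = (bead μ p - bead μ 0) + (-1) * ℓ by ring,
    Int.add_mul_ediv_right _ _ hl]
  have hn : (((ℓ - 1 : ℕ)) : ℤ) = (ℓ : ℤ) - 1 := by omega
  rw [hn]
  ring

end Phi

/-! ### Removing the boxes of one residue -/

/-- The action of the generator `s_i` on the positions of an abacus with `ℓ ≥ 2` runners: it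
exchanges each position of runner `i - 1` with the next position, which is on runner `i`. -/
def runnerSwap (ℓ : ℕ) (i : ZMod ℓ) (x : ℤ) : ℤ :=
  if (x : ZMod ℓ) = i then x - 1 else if (x : ZMod ℓ) = i - 1 then x + 1 else x

section RunnerSwap

variable {ℓ : ℕ}

theorem sub_one_ne (hℓ : 2 ≤ ℓ) (i : ZMod ℓ) : i - 1 ≠ i := by
  have : Fact (1 < ℓ) := ⟨hℓ⟩
  simp

theorem runnerSwap_of_eq {i : ZMod ℓ} {x : ℤ} (h : (x : ZMod ℓ) = i) :
    runnerSwap ℓ i x = x - 1 := if_pos h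

theorem runnerSwap_of_eq_sub_one (hℓ : 2 ≤ ℓ) {i : ZMod ℓ} {x : ℤ} (h : (x : ZMod ℓ) = i - 1) :
    runnerSwap ℓ i x = x + 1 := by
  rw [runnerSwap, if_neg (by rw [h]; exact sub_one_ne hℓ i), if_pos h]

theorem runnerSwap_of_ne {i : ZMod ℓ} {x : ℤ} (h : (x : ZMod ℓ) ≠ i) (h' : (x : ZMod ℓ) ≠ i - 1) :
    runnerSwap ℓ i x = x := by
  rw [runnerSwap, if_neg h, if_neg h']

theorem runnerSwap_involutive (hℓ : 2 ≤ ℓ) (i : ZMod ℓ) : Function.Involutive (runnerSwap ℓ i) := by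
  intro x
  by_cases h : (x : ZMod ℓ) = i
  · rw [runnerSwap_of_eq h, runnerSwap_of_eq_sub_one hℓ (by push_cast; rw [h])]
    ring
  · by_cases h' : (x : ZMod ℓ) = i - 1
    · rw [runnerSwap_of_eq_sub_one hℓ h', runnerSwap_of_eq (by push_cast; rw [h']; ring)]
      ring
    · rw [runnerSwap_of_ne h h', runnerSwap_of_ne h h']

theorem runnerSwap_sub (i : ZMod ℓ) (x : ℤ) :
    runnerSwap ℓ i (x - ℓ) = runnerSwap ℓ i x - ℓ := by
  simp only [runnerSwap, Int.cast_sub, Int.cast_natCast, ZMod.natCast_self, sub_zero]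
  split_ifs <;> ring

/-- The only pairs whose order changes under `runnerSwap` are the exchanged pairs. -/
theorem runnerSwap_lt (hℓ : 2 ≤ ℓ) {i : ZMod ℓ} {x y : ℤ} (h : x < y)
    (hne : (x : ZMod ℓ) = i - 1 → y ≠ x + 1) : runnerSwap ℓ i x < runnerSwap ℓ i y := by
  by_cases hx : (x : ZMod ℓ) = i - 1
  · have h1 := hne hx
    rw [runnerSwap_of_eq_sub_one hℓ hx]
    by_cases h2 : y = x + 2
    · subst h2
      have : ((x + 2 : ℤ) : ZMod ℓ) ≠ i := by
        push_cast
        rw [hx]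
        have : Fact (1 < ℓ) := ⟨hℓ⟩
        intro h
        have : (1 : ZMod ℓ) = 0 := by linear_combination h
        exact one_ne_zero this
      rw [runnerSwap, if_neg this]
      split_ifs <;> omega
    · rw [runnerSwap]
      split_ifs <;> omega
  · by_cases hy : (y : ZMod ℓ) = i
    · rw [runnerSwap_of_eq hy]
      have h1 : y ≠ x + 1 := by
        rintro rfl
        apply hx
        rw [← hy]
        push_cast
        ring
      rw [runnerSwap, if_neg hx]
      split_ifs with h2 <;> omega
    · simp only [runnerSwap, if_neg hx, if_neg hy]
      split_ifs <;> omega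

end RunnerSwap

section Remove

variable {ℓ : ℕ} {μ : YoungDiagram}

theorem mem_removeResidue {i : ZMod ℓ} {c : ℕ × ℕ} :
    c ∈ removeResidue ℓ i μ ↔ c ∈ μ ∧ ¬ (IsRemovable μ c ∧ residue ℓ c = i) := by
  rw [← YoungDiagram.mem_cells, removeResidue, Finset.mem_filter, YoungDiagram.mem_cells]

theorem removeResidue_le (i : ZMod ℓ) : removeResidue ℓ i μ ≤ μ :=
  fun _ hc => (mem_removeResidue.1 hc).1

theorem residue_lastBox (h : μ ≠ ⊥) : residue ℓ (lastBox μ) = (bead μ (lastRow μ) : ZMod ℓ) :=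
  residue_rowEnd (rowLen_lastRow_pos h)

theorem le_lastRow {p : ℕ} (hp : 0 < μ.rowLen p) : p ≤ lastRow μ := by
  have := rowLen_pos_iff.1 hp
  rw [lastRow]
  omega

/-- If the bottom row of a core ends in residue `i`, then no row ends in residue `i - 1`: otherwise
there would be a bead just before the bead of the bottom row. -/
theorem bead_ne_sub_one (hℓ : 0 < ℓ) (hμ : IsCore ℓ μ) (h : μ ≠ ⊥) {p : ℕ}
    (hp : 0 < μ.rowLen p) : (bead μ p : ZMod ℓ) ≠ residue ℓ (lastBox μ) - 1 := by
  intro heq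
  rw [residue_lastBox h] at heq
  have h1 : bead μ (lastRow μ) ≤ bead μ p := (bead_strictAnti μ).antitone (le_lastRow hp)
  obtain ⟨q, hq⟩ := mem_abacus_iff.1 (hμ.mem_abacus hℓ (bead_mem_abacus μ p)
    (y := bead μ (lastRow μ) - 1) (by omega) (by rw [heq]; push_cast; rfl))
  have h2 : lastRow μ < q := by
    rw [← (bead_strictAnti μ).lt_iff_gt, hq]
    omega
  have h3 : μ.rowLen q = 0 := by
    by_contra h3
    have := le_lastRow (Nat.pos_of_ne_zero h3)
    omega
  have h4 := rowLen_lastRow_pos h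
  simp only [bead, h3] at hq
  omega

/-- Every row ending in the residue of the last box loses exactly its last box. -/
theorem rowLen_removeResidue (hℓ : 0 < ℓ) (hμ : IsCore ℓ μ) (h : μ ≠ ⊥) (p : ℕ) :
    (removeResidue ℓ (residue ℓ (lastBox μ)) μ).rowLen p =
      μ.rowLen p - if 0 < μ.rowLen p ∧ (bead μ p : ZMod ℓ) = residue ℓ (lastBox μ) then 1
        else 0 := by
  set i := residue ℓ (lastBox μ) with hi
  have hkey : ∀ c, c < (removeResidue ℓ i μ).rowLen p ↔
      c < μ.rowLen p ∧ ¬ (c + 1 = μ.rowLen p ∧ (bead μ p : ZMod ℓ) = i) := by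
    intro c
    rw [← YoungDiagram.mem_iff_lt_rowLen, mem_removeResidue, YoungDiagram.mem_iff_lt_rowLen]
    refine and_congr_right fun hc => not_congr ?_
    have hres : c + 1 = μ.rowLen p → residue ℓ (p, c) = (bead μ p : ZMod ℓ) := by
      intro hc1
      rw [← residue_rowEnd (by omega), rowEnd, ← hc1]
      simp
    constructor
    · rintro ⟨⟨-, h1, -⟩, h2⟩
      have h3 : c + 1 = μ.rowLen p := by
        have := mt YoungDiagram.mem_iff_lt_rowLen.2 h1
        dsimp only at this
        omega
      exact ⟨h3, by rw [← hres h3, h2]⟩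
    · rintro ⟨h1, h2⟩
      refine ⟨⟨YoungDiagram.mem_iff_lt_rowLen.2 hc, ?_, ?_⟩, by rw [hres h1, h2]⟩
      · show (p, c + 1) ∉ μ
        rw [YoungDiagram.mem_iff_lt_rowLen]
        omega
      · show (p + 1, c) ∉ μ
        rw [YoungDiagram.mem_iff_lt_rowLen]
        intro h3
        -- otherwise the next row has the same length and ends in residue `i - 1`
        have h4 := μ.rowLen_anti p (p + 1) (by omega)
        refine bead_ne_sub_one hℓ hμ h (p := p + 1) (by omega) ?_
        rw [← hi, ← h2, bead, bead, show μ.rowLen (p + 1) = μ.rowLen p by omega]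
        push_cast
        ring
  split_ifs with hc
  · have h1 := hkey (μ.rowLen p - 1)
    have h2 := hkey (μ.rowLen p - 2)
    simp only [hc.2, and_true] at h1 h2
    omega
  · have h1 := hkey (μ.rowLen p - 1)
    have h2 := hkey (μ.rowLen p)
    rw [not_and] at hc
    rcases Nat.eq_zero_or_pos (μ.rowLen p) with h0 | h0
    · simp only [h0] at h2 ⊢
      omega
    · have := hc h0
      simp only [this, and_false, not_false_iff, and_true] at h1 h2
      omega

theorem bead_removeResidue (hℓ : 0 < ℓ) (hμ : IsCore ℓ μ) (h : μ ≠ ⊥) (p : ℕ) :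
    bead (removeResidue ℓ (residue ℓ (lastBox μ)) μ) p =
      bead μ p - if 0 < μ.rowLen p ∧ (bead μ p : ZMod ℓ) = residue ℓ (lastBox μ) then 1
        else 0 := by
  have := rowLen_removeResidue hℓ hμ h p
  rw [bead, this]
  split_ifs with hc
  · rw [bead]
    have := hc.1
    omega
  · rw [bead]
    simp

theorem abacus_removeResidue (hℓ : 2 ≤ ℓ) (hμ : IsCore ℓ μ) (h : μ ≠ ⊥) :
    abacus (removeResidue ℓ (residue ℓ (lastBox μ)) μ) =
      runnerSwap ℓ (residue ℓ (lastBox μ)) ⁻¹' abacus μ := by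
  have hℓ0 : 0 < ℓ := by omega
  set i := residue ℓ (lastBox μ) with hi
  set P := lastRow μ with hP
  have hPpos := rowLen_lastRow_pos h
  have hinv := runnerSwap_involutive hℓ i
  have hPi : (bead μ P : ZMod ℓ) = i := (residue_lastBox h).symm
  have hzero : ∀ p, P < p → μ.rowLen p = 0 := by
    intro p hp
    by_contra h3
    have := le_lastRow (Nat.pos_of_ne_zero h3)
    omega
  have hpos : ∀ p, p ≤ P → 0 < μ.rowLen p := fun p hp => hPpos.trans_le (μ.rowLen_anti _ _ hp)
  have hbead : ∀ p, p ≤ P → bead (removeResidue ℓ i μ) p = runnerSwap ℓ i (bead μ p) := by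
    intro p hp
    rw [bead_removeResidue hℓ0 hμ h, ← hi]
    simp only [hpos p hp, true_and]
    split_ifs with hc
    · rw [runnerSwap_of_eq hc]
    · rw [runnerSwap_of_ne hc (bead_ne_sub_one hℓ0 hμ h (hpos p hp)), sub_zero]
  have hbead' : ∀ p, P < p → bead (removeResidue ℓ i μ) p = -(p + 1) := by
    intro p hp
    have := hzero p hp
    rw [bead_removeResidue hℓ0 hμ h, bead, this]
    simp
  -- the gap of the first column is not on runner `i`, so the beads of the empty rows are permuted
  have hgap : ((-P - 1 : ℤ) : ZMod ℓ) ≠ i := by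
    intro hc
    have h1 := hμ.mem_abacus hℓ0 (bead_mem_abacus μ P) (y := -P - 1)
      (by simp only [bead]; omega) (by rw [hPi, hc])
    refine notMem_abacus_iff.2 ⟨0, ?_⟩ h1
    have := colLen_pos h
    simp only [gap, hP, lastRow]
    omega
  have hempty : ∀ x : ℤ, x ≤ -P - 2 → runnerSwap ℓ i x ≤ -P - 2 := by
    intro x hx
    rw [runnerSwap]
    split_ifs with h1 h2
    · omega
    · have : x ≠ -P - 2 := by
        rintro rfl
        apply hgap
        rw [eq_sub_iff_add_eq] at h2
        rw [← h2]
        push_cast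
        ring
      omega
    · exact hx
  ext x
  rw [Set.mem_preimage, mem_abacus_iff, mem_abacus_iff]
  constructor
  · rintro ⟨p, rfl⟩
    rcases le_or_gt p P with hp | hp
    · exact ⟨p, by rw [hbead p hp, hinv]⟩
    · rw [hbead' p hp]
      have h1 := hempty (-(p + 1)) (by omega)
      refine ⟨(-(runnerSwap ℓ i (-(p + 1))) - 1).toNat, ?_⟩
      rw [bead, hzero _ (by omega)]
      omega
  · rintro ⟨p, hp⟩
    have hx : x = runnerSwap ℓ i (bead μ p) := by rw [hp, hinv]
    rcases le_or_gt p P with hpP | hpP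
    · exact ⟨p, by rw [hbead p hpP, hx]⟩
    · have h1 : bead μ p = -(p + 1) := by simp [bead, hzero p hpP]
      have h2 := hempty (bead μ p) (by omega)
      refine ⟨(-(runnerSwap ℓ i (bead μ p)) - 1).toNat, ?_⟩
      rw [hbead' _ (by omega), hx]
      omega

theorem isCore_removeResidue (hℓ : 2 ≤ ℓ) (hμ : IsCore ℓ μ) (h : μ ≠ ⊥) :
    IsCore ℓ (removeResidue ℓ (residue ℓ (lastBox μ)) μ) := by
  rw [isCore_iff (by omega), abacus_removeResidue hℓ hμ h]
  intro x hx
  rw [Set.mem_preimage, runnerSwap_sub]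
  exact (isCore_iff (by omega)).1 hμ _ hx

theorem bot_of_isCore_one (hμ : IsCore 1 μ) : μ = ⊥ := by
  by_contra h
  exact hμ _ (lastBox_isRemovable h).1 (one_dvd _)

end Remove

section CanonicalWord

variable {ℓ : ℕ}

theorem canonicalWord_bot : canonicalWord ℓ ⊥ = [] := by
  rw [canonicalWord, dif_pos rfl]

theorem canonicalWord_of_ne {μ : YoungDiagram} (h : μ ≠ ⊥) :
    canonicalWord ℓ μ = residue ℓ (lastBox μ) ::
      canonicalWord ℓ (removeResidue ℓ (residue ℓ (lastBox μ)) μ) := by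
  rw [canonicalWord, dif_neg h]

/-- Induction over cores along their canonical words. -/
theorem core_induction (hℓ : 2 ≤ ℓ) {P : YoungDiagram → Prop} (bot : P ⊥)
    (step : ∀ μ, IsCore ℓ μ → μ ≠ ⊥ →
      IsCore ℓ (removeResidue ℓ (residue ℓ (lastBox μ)) μ) →
      P (removeResidue ℓ (residue ℓ (lastBox μ)) μ) → P μ)
    {μ : YoungDiagram} (hμ : IsCore ℓ μ) : P μ := by
  induction hn : μ.card using Nat.strong_induction_on generalizing μ with
  | _ n ih =>
    by_cases h : μ = ⊥
    · exact h ▸ bot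
    · have hc := isCore_removeResidue hℓ hμ h
      exact step μ hμ h hc (ih _ (hn ▸ card_removeResidue_lt ℓ h) hc rfl)

end CanonicalWord

/-! ### The action of the affine symmetric group on flush abaci -/

section Flush

variable {ℓ : ℕ}

theorem sub_one_ediv (hℓ : 0 < ℓ) (x : ℤ) :
    (x - 1) / (ℓ : ℤ) = x / ℓ - if (x : ZMod ℓ) = 0 then 1 else 0 := by
  have hl : (0 : ℤ) < ℓ := by omega
  have h0 := Int.emod_nonneg x hl.ne'
  have h1 := Int.emod_lt_of_pos x hl
  have h2 := Int.mul_ediv_add_emod x ℓ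
  have hz : (x : ZMod ℓ) = 0 ↔ x % ℓ = 0 := by
    rw [← Int.dvd_iff_emod_eq_zero]
    exact ZMod.intCast_zmod_eq_zero_iff_dvd x ℓ
  split_ifs with h
  · rw [hz] at h
    rw [show x - 1 = (ℓ - 1) + (x / ℓ - 1) * ℓ by linarith, Int.add_mul_ediv_right _ _ hl.ne',
      Int.ediv_eq_zero_of_lt (by omega) (by omega)]
    ring
  · rw [hz] at h
    rw [show x - 1 = (x % ℓ - 1) + (x / ℓ) * ℓ by linarith, Int.add_mul_ediv_right _ _ hl.ne',
      Int.ediv_eq_zero_of_lt (by omega) (by omega)]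
    ring

theorem flushAbacus_reflFun (hℓ : 2 ≤ ℓ) (i : ZMod ℓ) (v : ZMod ℓ → ℝ) :
    flushAbacus ℓ (reflFun ℓ i v) = runnerSwap ℓ i ⁻¹' flushAbacus ℓ v := by
  have hℓ0 : 0 < ℓ := by omega
  have h01 : (0 : ZMod ℓ) ≠ -1 := by
    have := sub_one_ne hℓ 0
    rwa [zero_sub, ne_comm] at this
  ext x
  rw [Set.mem_preimage]
  simp only [flushAbacus, Set.mem_ofPred_eq, reflFun]
  by_cases hx : (x : ZMod ℓ) = i
  · rw [runnerSwap_of_eq hx, hx, Equiv.swap_apply_right, sub_one_ediv hℓ0, hx]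
    push_cast
    rw [hx]
    by_cases hi : i = 0
    · simp [hi, h01]
    · simp [hi]
  · by_cases hx' : (x : ZMod ℓ) = i - 1
    · have h1 : ((x + 1 : ℤ) : ZMod ℓ) = i := by push_cast; rw [hx']; ring
      have h2 := sub_one_ediv hℓ0 (x + 1)
      rw [add_sub_cancel_right, h1] at h2
      rw [runnerSwap_of_eq_sub_one hℓ hx', hx', Equiv.swap_apply_left, h1, h2]
      push_cast
      by_cases hi : i = 0
      · simp [hi, h01.symm]
      · simp [hi]
    · rw [runnerSwap_of_ne hx hx', Equiv.swap_apply_of_ne_of_ne hx' hx]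
      by_cases hi : i = 0
      · subst hi
        rw [zero_sub] at hx'
        simp [hx, hx']
      · simp [hi]

theorem flushAbacus_sub (hℓ : 0 < ℓ) {v : ZMod ℓ → ℝ} {x : ℤ} (hx : x ∈ flushAbacus ℓ v) :
    x - ℓ ∈ flushAbacus ℓ v := by
  have h1 : (x - ℓ) / (ℓ : ℤ) = x / ℓ - 1 := by
    rw [show x - (ℓ : ℤ) = x + (-1) * ℓ by ring, Int.add_mul_ediv_right _ _ (by omega)]
    ring
  have hx' : ((x / (ℓ : ℤ) : ℤ) : ℝ) ≤ v (x : ZMod ℓ) := hx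
  show (((x - ℓ) / (ℓ : ℤ) : ℤ) : ℝ) ≤ v ((x - ℓ : ℤ) : ZMod ℓ)
  rw [h1]
  push_cast
  rw [ZMod.natCast_self, sub_zero]
  linarith

theorem flushAbacus_zero (hℓ : 0 < ℓ) :
    flushAbacus ℓ 0 = (fun x => x - (ℓ : ℤ)) ⁻¹' abacus ⊥ := by
  have hl : (0 : ℤ) < ℓ := by omega
  ext x
  have h1 : x ∈ flushAbacus ℓ 0 ↔ x < ℓ := by
    show ((x / (ℓ : ℤ) : ℤ) : ℝ) ≤ 0 ↔ _
    rw [← Int.cast_zero, Int.cast_le, ← Int.lt_add_one_iff, Int.ediv_lt_iff_lt_mul hl]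
    simp
  rw [h1, Set.mem_preimage, mem_abacus_iff]
  constructor
  · intro h
    refine ⟨(ℓ - 1 - x).toNat, ?_⟩
    rw [bead, rowLen_bot]
    omega
  · rintro ⟨p, hp⟩
    rw [bead, rowLen_bot] at hp
    omega

end Flush

section Group

variable {ℓ : ℕ} [NeZero ℓ]

/-- The vector `w(0)`, by whose flush abacus the core `w(∅)` is defined. -/
def originImage (w : AffineSymmetricGroup ℓ) : ZMod ℓ → ℝ :=
  ((w : Equiv.Perm (rootSpace ℓ)) 0 : rootSpace ℓ)

theorem wordProd_cons_apply (i : ZMod ℓ) (u : List (ZMod ℓ)) (v : rootSpace ℓ) :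
    (((wordProd ℓ (i :: u) : Equiv.Perm (rootSpace ℓ)) v : rootSpace ℓ) : ZMod ℓ → ℝ) =
      reflFun ℓ i ((wordProd ℓ u : Equiv.Perm (rootSpace ℓ)) v : rootSpace ℓ) := by
  rw [wordProd, List.map_cons, List.prod_cons]
  rfl

theorem wordProd_append_singleton (u : List (ZMod ℓ)) (i : ZMod ℓ) :
    wordProd ℓ (u ++ [i]) = wordProd ℓ u * coxeterGen ℓ i := by
  simp [wordProd]

theorem originImage_nil : originImage (wordProd ℓ []) = 0 := rfl

theorem originImage_cons (i : ZMod ℓ) (u : List (ZMod ℓ)) :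
    originImage (wordProd ℓ (i :: u)) = reflFun ℓ i (originImage (wordProd ℓ u)) :=
  wordProd_cons_apply i u 0

theorem originImage_mul_coxeterGen (w : AffineSymmetricGroup ℓ) {i : ZMod ℓ} (hi : i ≠ 0) :
    originImage (w * coxeterGen ℓ i) = originImage w := by
  have : reflV ℓ i 0 = 0 := by
    apply Subtype.ext
    funext j
    show reflFun ℓ i 0 j = 0
    simp [reflFun, hi]
  show (((w : Equiv.Perm (rootSpace ℓ)) (reflV ℓ i 0) : rootSpace ℓ) : ZMod ℓ → ℝ) = _
  rw [this]
  rfl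

theorem flushAbacus_canonicalWord (hℓ : 2 ≤ ℓ) {μ : YoungDiagram} (hμ : IsCore ℓ μ) :
    flushAbacus ℓ (originImage (wordProd ℓ (canonicalWord ℓ μ))) =
      (fun x => x - (ℓ : ℤ)) ⁻¹' abacus μ := by
  refine core_induction (P := fun μ => flushAbacus ℓ (originImage (wordProd ℓ
    (canonicalWord ℓ μ))) = (fun x => x - (ℓ : ℤ)) ⁻¹' abacus μ) hℓ ?_ ?_ hμ
  · rw [canonicalWord_bot, originImage_nil, flushAbacus_zero (by omega)]
  · intro μ hμ h _ ih
    rw [canonicalWord_of_ne h, originImage_cons, flushAbacus_reflFun hℓ, ih,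
      abacus_removeResidue hℓ hμ h]
    ext x
    simp only [Set.mem_preimage]
    rw [← runnerSwap_sub, runnerSwap_involutive hℓ]

theorem coreOf_canonicalWord (hℓ : 2 ≤ ℓ) {μ : YoungDiagram} (hμ : IsCore ℓ μ) :
    coreOf ℓ (wordProd ℓ (canonicalWord ℓ μ)) = μ := by
  show partitionOfAbacus (flushAbacus ℓ (originImage (wordProd ℓ (canonicalWord ℓ μ)))) = μ
  rw [flushAbacus_canonicalWord hℓ hμ, partitionOfAbacus_translate]

end Group

/-! ### The length of a coset -/

/-- The inversions of a flush abacus `A`: pairs of the first gap of some runner and a bead after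
it.  Their number is the length of the minimal representative of the coset indexed by `A`. -/
def abacusInversions (ℓ : ℕ) (A : Set ℤ) : Set (ℤ × ℤ) :=
  {z | z.1 ∉ A ∧ z.1 - ℓ ∈ A ∧ z.2 ∈ A ∧ z.1 < z.2}

section Inversions

variable {ℓ : ℕ}

theorem abacusInversions_runnerSwap_subset (hℓ : 2 ≤ ℓ) (i : ZMod ℓ) {A : Set ℤ} :
    abacusInversions ℓ (runnerSwap ℓ i ⁻¹' A) ⊆
      Prod.map (runnerSwap ℓ i) (runnerSwap ℓ i) '' abacusInversions ℓ A ∪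
      {z | z ∈ abacusInversions ℓ (runnerSwap ℓ i ⁻¹' A) ∧ (z.1 : ZMod ℓ) = i - 1 ∧
        z.2 = z.1 + 1} := by
  rintro ⟨a, d⟩ h
  have hinv := runnerSwap_involutive hℓ i
  by_cases hs : (a : ZMod ℓ) = i - 1 ∧ d = a + 1
  · exact Or.inr ⟨h, hs⟩
  · left
    obtain ⟨h1, h2, h3, h4⟩ := h
    refine ⟨(runnerSwap ℓ i a, runnerSwap ℓ i d), ⟨h1, ?_, h3, ?_⟩, ?_⟩
    · rw [← runnerSwap_sub]; exact h2
    · exact runnerSwap_lt hℓ h4 fun ha hd => hs ⟨ha, hd⟩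
    · simp [hinv a, hinv d]

/-- A generator creates at most one inversion. -/
theorem ncard_abacusInversions_runnerSwap_le (hℓ : 2 ≤ ℓ) (i : ZMod ℓ) {A : Set ℤ}
    (hA : ∀ x ∈ runnerSwap ℓ i ⁻¹' A, x - ℓ ∈ runnerSwap ℓ i ⁻¹' A)
    (hfin : (abacusInversions ℓ A).Finite) :
    (abacusInversions ℓ (runnerSwap ℓ i ⁻¹' A)).Finite ∧
      (abacusInversions ℓ (runnerSwap ℓ i ⁻¹' A)).ncard ≤ (abacusInversions ℓ A).ncard + 1 := by
  have hsub := abacusInversions_runnerSwap_subset hℓ i (A := A)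
  set E := {z : ℤ × ℤ | z ∈ abacusInversions ℓ (runnerSwap ℓ i ⁻¹' A) ∧ (z.1 : ZMod ℓ) = i - 1 ∧
    z.2 = z.1 + 1} with hE
  -- runner `i - 1` has only one first gap
  have hsing : E.Subsingleton := by
    have key : ∀ z ∈ E, ∀ z' ∈ E, ¬ z.1 < z'.1 := by
      rintro ⟨a, d⟩ ⟨⟨h1, -, -, -⟩, h5, -⟩ ⟨a', d'⟩ ⟨⟨-, h2', -, -⟩, h5', -⟩ hlt
      obtain ⟨m, hm⟩ := (ZMod.intCast_eq_intCast_iff_dvd_sub _ _ _).1 (h5.trans h5'.symm)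
      have hm0 : 0 < m := by
        by_contra hneg
        have : (ℓ : ℤ) * m ≤ 0 := mul_nonpos_of_nonneg_of_nonpos (by omega) (by omega)
        dsimp only at hm hlt
        omega
      have : (ℓ : ℤ) * 1 ≤ ℓ * m := mul_le_mul_of_nonneg_left hm0 (by omega)
      dsimp only at hm hlt h5 h5'
      refine h1 (mem_of_flush (by omega) hA h2' (by omega) ?_)
      push_cast
      rw [h5, h5', ZMod.natCast_self, sub_zero]
    intro z hz z' hz'
    have h1 : z.1 = z'.1 := le_antisymm (not_lt.1 (key _ hz' _ hz)) (not_lt.1 (key _ hz _ hz'))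
    exact Prod.ext h1 (by rw [hz.2.2, hz'.2.2, h1])
  have hf := (hfin.image (Prod.map (runnerSwap ℓ i) (runnerSwap ℓ i))).union hsing.finite
  refine ⟨hf.subset hsub, ?_⟩
  calc _ ≤ _ := Set.ncard_le_ncard hsub hf
    _ ≤ _ := Set.ncard_union_le _ _
    _ ≤ _ := add_le_add (Set.ncard_image_le hfin)
      ((Set.ncard_le_one hsing.finite).2 fun a ha b hb => hsing ha hb)

/-- If runner `i` of a flush abacus `A` is longer than runner `i - 1`, then exchanging the two
removes an inversion. -/
theorem ncard_abacusInversions_runnerSwap_lt (hℓ : 2 ≤ ℓ) (i : ZMod ℓ) {A : Set ℤ}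
    (hA : ∀ x ∈ A, x - ℓ ∈ A) (hfin : (abacusInversions ℓ A).Finite) {a₀ : ℤ}
    (ha₀ : (a₀ : ZMod ℓ) = i - 1) (h1 : a₀ ∉ A) (h2 : a₀ - ℓ ∈ A) (h3 : a₀ + 1 ∈ A) :
    (abacusInversions ℓ (runnerSwap ℓ i ⁻¹' A)).ncard < (abacusInversions ℓ A).ncard := by
  have hinv := runnerSwap_involutive hℓ i
  rw [← Set.ncard_image_of_injective (f := Prod.map (runnerSwap ℓ i) (runnerSwap ℓ i)) _
    (hinv.injective.prodMap hinv.injective)]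
  refine Set.ncard_lt_ncard ?_ hfin
  rw [Set.ssubset_iff_of_subset]
  · refine ⟨(a₀, a₀ + 1), ⟨h1, h2, h3, by simp⟩, ?_⟩
    rintro ⟨⟨a, d⟩, ⟨-, -, -, hlt⟩, h⟩
    simp only [Prod.map_apply, Prod.mk.injEq] at h
    have e1 : a = a₀ + 1 := by
      rw [← hinv a, h.1, runnerSwap_of_eq_sub_one hℓ ha₀]
    have e2 : d = a₀ := by
      rw [← hinv d, h.2, runnerSwap_of_eq (by push_cast; rw [ha₀]; ring)]
      ring
    dsimp only at hlt
    omega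
  · rintro _ ⟨⟨a, d⟩, ⟨g1, g2, g3, g4⟩, rfl⟩
    rw [Set.mem_preimage] at g1 g2 g3
    dsimp only at g1 g2 g3 g4
    refine ⟨g1, ?_, g3, runnerSwap_lt hℓ g4 fun ha hd => ?_⟩
    · rw [runnerSwap_sub] at g2; exact g2
    · have ha1 : ((a + 1 : ℤ) : ZMod ℓ) = i := by push_cast; rw [ha]; ring
      rw [runnerSwap_of_eq_sub_one hℓ ha] at g1
      rw [hd, runnerSwap_of_eq ha1, add_sub_cancel_right] at g3
      have hlt : a < a₀ := by
        by_contra hle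
        exact h1 (mem_of_flush (by omega) hA g3 (by omega) (by rw [ha, ha₀]))
      refine g1 (mem_of_flush (by omega) hA h3 (by omega) ?_)
      rw [ha1]
      push_cast
      rw [ha₀]
      ring

/-- If `i` is the residue of the last box, then the first gap of runner `i - 1` comes just before a
bead. -/
theorem exists_first_gap (hℓ : 0 < ℓ) {μ : YoungDiagram} (hμ : IsCore ℓ μ) (h : μ ≠ ⊥) :
    ∃ a : ℤ, (a : ZMod ℓ) = residue ℓ (lastBox μ) - 1 ∧ a ∉ abacus μ ∧ a - ℓ ∈ abacus μ ∧
      a + 1 ∈ abacus μ := by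
  set x := bead μ (lastRow μ) with hx
  have hxi : (x : ZMod ℓ) = residue ℓ (lastBox μ) := (residue_lastBox h).symm
  have hx1 : x - 1 ∉ abacus μ := by
    intro hmem
    obtain ⟨q, hq⟩ := mem_abacus_iff.1 hmem
    have hlt : lastRow μ < q := by
      rw [← (bead_strictAnti μ).lt_iff_gt, hq]
      omega
    have h3 : μ.rowLen q = 0 := by
      by_contra h3
      have := le_lastRow (Nat.pos_of_ne_zero h3)
      omega
    have h4 := rowLen_lastRow_pos h
    simp only [bead, h3] at hq hx
    omega
  have hex : ∃ m : ℕ, x - 1 - ℓ * m ∈ abacus μ := by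
    by_contra! hcon
    obtain ⟨q, hq⟩ := notMem_abacus_iff.1 (hcon (x - 1 + μ.colLen 0 + 1).toNat)
    have h1 := (gap_strictMono μ).monotone (Nat.zero_le q)
    have h2 : ((x - 1 + μ.colLen 0 + 1).toNat : ℤ) ≤ ℓ * (x - 1 + μ.colLen 0 + 1).toNat :=
      le_mul_of_one_le_left (by omega) (by omega)
    simp only [gap] at h1 hq
    omega
  classical
  obtain ⟨m, hm, hmin⟩ : ∃ m : ℕ, x - 1 - ℓ * m ∈ abacus μ ∧
      ∀ r < m, x - 1 - ℓ * (r : ℤ) ∉ abacus μ :=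
    ⟨Nat.find hex, Nat.find_spec hex, fun r hr => Nat.find_min hex hr⟩
  cases m with
  | zero => exact absurd (by simpa using hm) hx1
  | succ m =>
    refine ⟨x - 1 - ℓ * m, ?_, hmin m (by omega), ?_, ?_⟩
    · push_cast
      rw [hxi, ZMod.natCast_self]
      ring
    · convert hm using 1
      push_cast
      ring
    · refine hμ.mem_abacus hℓ (bead_mem_abacus μ (lastRow μ)) ?_ ?_
      · have : (0 : ℤ) ≤ ℓ * m := by positivity
        omega
      · rw [← hx]
        push_cast
        rw [ZMod.natCast_self]
        ring

variable [NeZero ℓ]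

theorem ncard_abacusInversions_le_length (hℓ : 2 ≤ ℓ) (u : List (ZMod ℓ)) :
    (abacusInversions ℓ (flushAbacus ℓ (originImage (wordProd ℓ u)))).Finite ∧
      (abacusInversions ℓ (flushAbacus ℓ (originImage (wordProd ℓ u)))).ncard ≤ u.length := by
  induction u with
  | nil =>
    have : abacusInversions ℓ (flushAbacus ℓ (originImage (wordProd ℓ []))) = ∅ := by
      rw [originImage_nil, Set.eq_empty_iff_forall_notMem]
      rintro ⟨a, d⟩ ⟨h1, -, h3, h4⟩
      refine h1 ?_
      have h3' : ((d / (ℓ : ℤ) : ℤ) : ℝ) ≤ 0 := h3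
      show ((a / (ℓ : ℤ) : ℤ) : ℝ) ≤ 0
      have := Int.ediv_le_ediv (c := (ℓ : ℤ)) (by omega) (le_of_lt h4)
      exact le_trans (by exact_mod_cast this) h3'
    rw [this]
    simp
  | cons i u ih =>
    rw [originImage_cons, flushAbacus_reflFun hℓ]
    obtain ⟨h1, h2⟩ := ncard_abacusInversions_runnerSwap_le hℓ i (by
      rw [← flushAbacus_reflFun hℓ]
      exact fun x hx => flushAbacus_sub (by omega) hx) ih.1
    refine ⟨h1, h2.trans ?_⟩
    rw [List.length_cons]
    exact Nat.succ_le_succ ih.2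

theorem length_canonicalWord_le (hℓ : 2 ≤ ℓ) {μ : YoungDiagram} (hμ : IsCore ℓ μ) :
    (canonicalWord ℓ μ).length ≤ (abacusInversions ℓ
      (flushAbacus ℓ (originImage (wordProd ℓ (canonicalWord ℓ μ))))).ncard := by
  refine core_induction (P := fun μ => (canonicalWord ℓ μ).length ≤ (abacusInversions ℓ
    (flushAbacus ℓ (originImage (wordProd ℓ (canonicalWord ℓ μ))))).ncard) hℓ ?_ ?_ hμ
  · rw [canonicalWord_bot]
    exact Nat.zero_le _
  · intro μ hμ h _ ih
    obtain ⟨a, h1, h2, h3, h4⟩ := exists_first_gap (by omega) hμ h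
    have hA := flushAbacus_canonicalWord hℓ hμ
    have hmem : ∀ x : ℤ, x ∈ flushAbacus ℓ (originImage (wordProd ℓ (canonicalWord ℓ μ))) ↔
        x - ℓ ∈ abacus μ := fun x => by rw [hA]; rfl
    have hstep := ncard_abacusInversions_runnerSwap_lt hℓ (residue ℓ (lastBox μ))
      (fun x hx => flushAbacus_sub (by omega) hx)
      (ncard_abacusInversions_le_length hℓ (canonicalWord ℓ μ)).1 (a₀ := a + ℓ)
      (by push_cast; rw [h1, ZMod.natCast_self, add_zero])
      (by rw [hmem, add_sub_cancel_right]; exact h2)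
      (by rw [hmem, add_sub_cancel_right]; exact h3)
      (by rw [hmem]; convert h4 using 1; ring)
    rw [← flushAbacus_reflFun hℓ] at hstep
    have hback : reflFun ℓ (residue ℓ (lastBox μ)) (originImage (wordProd ℓ (canonicalWord ℓ μ))) =
        originImage (wordProd ℓ
          (canonicalWord ℓ (removeResidue ℓ (residue ℓ (lastBox μ)) μ))) := by
      rw [canonicalWord_of_ne h, originImage_cons, reflFun_reflFun]
    rw [hback] at hstep
    have hlen : (canonicalWord ℓ μ).length =
        (canonicalWord ℓ (removeResidue ℓ (residue ℓ (lastBox μ)) μ)).length + 1 := by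
      rw [canonicalWord_of_ne h, List.length_cons]
    omega

end Inversions

/-! ### Reduced words -/

section Reduced

variable {ℓ : ℕ} [NeZero ℓ]

theorem exists_linearPart (hℓ : 2 ≤ ℓ) (u : List (ZMod ℓ)) :
    ∃ (σ : Equiv.Perm (ZMod ℓ)) (t : ZMod ℓ → ℝ), Equiv.Perm.sign σ = (-1) ^ u.length ∧
      ∀ (v : rootSpace ℓ) (j : ZMod ℓ),
        (((wordProd ℓ u : Equiv.Perm (rootSpace ℓ)) v : rootSpace ℓ) : ZMod ℓ → ℝ) j =
          (v : ZMod ℓ → ℝ) (σ j) + t j := by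
  induction u with
  | nil => exact ⟨1, 0, by simp, fun v j => by simp [wordProd]⟩
  | cons i u ih =>
    obtain ⟨σ, t, h1, h2⟩ := ih
    refine ⟨σ * Equiv.swap (i - 1) i, fun j => t (Equiv.swap (i - 1) i j) +
      if i = 0 then (if j = 0 then 1 else 0) - (if j = -1 then 1 else 0) else 0, ?_, ?_⟩
    · rw [Equiv.Perm.sign_mul, h1, Equiv.Perm.sign_swap (sub_one_ne hℓ i), List.length_cons,
        pow_succ]
    · intro v j
      rw [wordProd_cons_apply, reflFun, h2, Equiv.Perm.mul_apply, add_assoc]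

/-- Words of one element have lengths of the same parity, since the linear part of `s_i` is a
transposition of the coordinates. -/
theorem length_parity (hℓ : 2 ≤ ℓ) {u u' : List (ZMod ℓ)} (h : wordProd ℓ u = wordProd ℓ u') :
    (-1 : ℤˣ) ^ u.length = (-1) ^ u'.length := by
  obtain ⟨σ, t, h1, h2⟩ := exists_linearPart hℓ u
  obtain ⟨σ', t', h1', h2'⟩ := exists_linearPart hℓ u'
  rw [← h1, ← h1']
  congr 1
  have ht : ∀ j, t j = t' j := by
    intro j
    have e1 := h2 0 j
    have e2 := h2' 0 j
    rw [← h, e1] at e2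
    simpa using e2
  ext j
  by_contra hne
  have hne' : σ j ≠ σ' j := fun e => hne (by rw [e])
  let v : rootSpace ℓ := ⟨Pi.single (σ j) 1 - Pi.single (σ' j) 1, by
    show ∑ k, _ = _
    simp⟩
  have e1 := h2 v j
  have e2 := h2' v j
  rw [← h, e1, ht j] at e2
  have e3 : (Pi.single (σ j) 1 - Pi.single (σ' j) 1 : ZMod ℓ → ℝ) (σ j) =
      (Pi.single (σ j) 1 - Pi.single (σ' j) 1 : ZMod ℓ → ℝ) (σ' j) := add_right_cancel e2
  simp only [Pi.sub_apply, Pi.single_eq_same, Pi.single_eq_of_ne hne',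
    Pi.single_eq_of_ne hne'.symm] at e3
  norm_num at e3

theorem exists_length_eq_coxeterLength (u : List (ZMod ℓ)) :
    ∃ u' : List (ZMod ℓ), wordProd ℓ u' = wordProd ℓ u ∧
      u'.length = coxeterLength ℓ (wordProd ℓ u) :=
  Nat.sInf_mem (s := {n | ∃ u' : List (ZMod ℓ), wordProd ℓ u' = wordProd ℓ u ∧ u'.length = n})
    ⟨u.length, u, rfl, rfl⟩

theorem coxeterLength_le (u : List (ZMod ℓ)) : coxeterLength ℓ (wordProd ℓ u) ≤ u.length :=
  Nat.sInf_le ⟨u, rfl, rfl⟩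

theorem isReducedWordOf_canonicalWord_of_two_le (hℓ : 2 ≤ ℓ) {μ : YoungDiagram}
    (hμ : IsCore ℓ μ) : IsReducedWordOf ℓ (canonicalWord ℓ μ) μ := by
  have hle := length_canonicalWord_le hℓ hμ
  set u := canonicalWord ℓ μ with hu
  -- every element of the coset of `wordProd ℓ u` has length at least `u.length`
  have hlow : ∀ u', originImage (wordProd ℓ u') = originImage (wordProd ℓ u) →
      u.length ≤ coxeterLength ℓ (wordProd ℓ u') := by
    intro u' h'
    obtain ⟨u'', h1, h2⟩ := exists_length_eq_coxeterLength u'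
    rw [← h2]
    refine hle.trans ?_
    rw [← h', ← h1]
    exact (ncard_abacusInversions_le_length hℓ u'').2
  have hlen : coxeterLength ℓ (wordProd ℓ u) = u.length :=
    le_antisymm (coxeterLength_le u) (hlow u rfl)
  refine ⟨hlen, ?_, coreOf_canonicalWord hℓ hμ⟩
  intro i hi
  rw [hlen, ← wordProd_append_singleton]
  refine lt_of_le_of_ne (hlow _ ?_) fun heq => ?_
  · rw [wordProd_append_singleton, originImage_mul_coxeterGen _ hi]
  · obtain ⟨u'', h1, h2⟩ := exists_length_eq_coxeterLength (u ++ [i])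
    have := length_parity hℓ h1
    rw [h2, ← heq, List.length_append, List.length_singleton, pow_succ] at this
    simp at this

theorem isReducedWordOf_canonicalWord {μ : YoungDiagram} (hμ : IsCore ℓ μ) :
    IsReducedWordOf ℓ (canonicalWord ℓ μ) μ := by
  rcases (Nat.one_le_iff_ne_zero.2 (NeZero.ne ℓ)).eq_or_lt with h1 | h2
  · subst h1
    obtain rfl := bot_of_isCore_one hμ
    rw [canonicalWord_bot]
    refine ⟨Nat.le_zero.1 (coxeterLength_le []), fun i hi => absurd (Subsingleton.elim i 0) hi, ?_⟩
    show partitionOfAbacus (flushAbacus 1 (originImage (wordProd 1 []))) = ⊥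
    rw [originImage_nil, flushAbacus_zero one_pos, partitionOfAbacus_translate]
  · exact isReducedWordOf_canonicalWord_of_two_le h2 hμ

end Reduced

/-! ### Deleting a runner and removing the boxes of one residue -/

section PhiRemove

variable {ℓ : ℕ} {μ : YoungDiagram}

theorem Phi_bot (hℓ : 2 ≤ ℓ) : Phi ℓ ⊥ = ⊥ := by
  ext ⟨r, c⟩
  rw [YoungDiagram.mem_cells, mem_Phi hℓ fun c hc => absurd hc (YoungDiagram.notMem_bot c)]
  simp [rowLen_bot]

/-- Removing the boxes of one residue from a core preserves the equivalence of nonempty rows. -/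
theorem runner_removeResidue_eq_iff (hℓ : 0 < ℓ) (hμ : IsCore ℓ μ) (h : μ ≠ ⊥) {p q : ℕ}
    (hp : 0 < μ.rowLen p) (hq : 0 < μ.rowLen q) :
    (bead (removeResidue ℓ (residue ℓ (lastBox μ)) μ) p : ZMod ℓ) =
        bead (removeResidue ℓ (residue ℓ (lastBox μ)) μ) q ↔
      (bead μ p : ZMod ℓ) = bead μ q := by
  rw [bead_removeResidue hℓ hμ h, bead_removeResidue hℓ hμ h]
  have hp' := bead_ne_sub_one hℓ hμ h hp
  have hq' := bead_ne_sub_one hℓ hμ h hq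
  generalize residue ℓ (lastBox μ) = i at *
  simp only [hp, hq, true_and]
  push_cast
  split_ifs with h1 h2 h2
  · simp [h1, h2]
  · rw [h1, sub_zero]
    exact ⟨fun e => absurd e.symm hq', fun e => absurd e.symm h2⟩
  · rw [h2, sub_zero]
    exact ⟨fun e => absurd e hp', fun e => absurd e h1⟩
  · simp

theorem keptRows_removeResidue (hℓ : 0 < ℓ) (hμ : IsCore ℓ μ) (h : μ ≠ ⊥) {p : ℕ}
    (hp : 0 < μ.rowLen p) :
    keptRows ℓ (removeResidue ℓ (residue ℓ (lastBox μ)) μ) p = keptRows ℓ μ p := by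
  rw [keptRows, keptRows, Nat.count_eq_card_filter_range, Nat.count_eq_card_filter_range]
  congr 1
  refine Finset.filter_congr fun s hs => not_congr ?_
  rw [Finset.mem_range] at hs
  exact runner_removeResidue_eq_iff hℓ hμ h (hp.trans_le (μ.rowLen_anti _ _ hs.le))
    (hp.trans_le (μ.rowLen_anti _ _ (Nat.zero_le p)))

theorem rowLen_removeResidue_le (p : ℕ) (i : ZMod ℓ) :
    (removeResidue ℓ i μ).rowLen p ≤ μ.rowLen p := by
  by_contra hlt
  have := removeResidue_le i (YoungDiagram.mem_iff_lt_rowLen.2 (not_le.1 hlt))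
  exact lt_irrefl _ (YoungDiagram.mem_iff_lt_rowLen.1 this)

/-- If the first and the last row are equivalent, only deleted rows are shortened. -/
theorem Phi_removeResidue_of_eq (hℓ : 2 ≤ ℓ) (hμ : IsCore ℓ μ) (h : μ ≠ ⊥)
    (h0 : (bead μ 0 : ZMod ℓ) = residue ℓ (lastBox μ)) :
    Phi ℓ (removeResidue ℓ (residue ℓ (lastBox μ)) μ) = Phi ℓ μ := by
  have hℓ0 : 0 < ℓ := by omega
  have hrow0 : 0 < μ.rowLen 0 :=
    (rowLen_lastRow_pos h).trans_le (μ.rowLen_anti _ _ (Nat.zero_le _))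
  ext ⟨r, c⟩
  rw [YoungDiagram.mem_cells, YoungDiagram.mem_cells, mem_Phi hℓ (isCore_removeResidue hℓ hμ h),
    mem_Phi hℓ hμ]
  refine exists_congr fun p => ?_
  rcases Nat.eq_zero_or_pos (μ.rowLen p) with hp | hp
  · have := rowLen_removeResidue_le (μ := μ) p (residue ℓ (lastBox μ))
    constructor <;> rintro ⟨-, -, hc⟩ <;> omega
  · rw [keptRows_removeResidue hℓ0 hμ h hp, Ne, Ne,
      runner_removeResidue_eq_iff hℓ0 hμ h hp hrow0]
    refine and_congr_right fun hne => ?_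
    rw [rowLen_removeResidue hℓ0 hμ h, if_neg (by rw [← h0]; exact fun hc => hne hc.2), Nat.sub_zero]

/-- The last row is not among the rows that `Φ` deletes. -/
theorem lastRow_kept (h : μ ≠ ⊥)
    (h0 : (bead μ 0 : ZMod ℓ) ≠ residue ℓ (lastBox μ)) :
    (bead μ (lastRow μ) : ZMod ℓ) ≠ bead μ 0 := by
  rw [← residue_lastBox h]
  exact h0.symm

theorem lastRow_Phi (h : μ ≠ ⊥)
    (h0 : (bead μ 0 : ZMod ℓ) ≠ residue ℓ (lastBox μ)) (hℓ : 2 ≤ ℓ)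
    (hμ : IsCore ℓ μ) :
    Phi ℓ μ ≠ ⊥ ∧ lastRow (Phi ℓ μ) = keptRows ℓ μ (lastRow μ) := by
  have hP := lastRow_kept h h0
  have hmem : ∀ r, (r, 0) ∈ Phi ℓ μ ↔ r ≤ keptRows ℓ μ (lastRow μ) := by
    intro r
    rw [mem_Phi hℓ hμ]
    constructor
    · rintro ⟨p, -, h1, h2⟩
      exact h1.trans (Nat.count_monotone _ (le_lastRow h2))
    · intro hr
      exact ⟨_, hP, hr, rowLen_lastRow_pos h⟩
  refine ⟨fun hbot => YoungDiagram.notMem_bot _ (hbot ▸ (hmem 0).2 (Nat.zero_le _)), ?_⟩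
  have h1 := YoungDiagram.mem_iff_lt_colLen.1 ((hmem _).2 le_rfl)
  have h2 := mt YoungDiagram.mem_iff_lt_colLen.2
    (mt (hmem (keptRows ℓ μ (lastRow μ) + 1)).1 (by omega))
  rw [lastRow]
  omega

theorem lastBox_Phi (h : μ ≠ ⊥)
    (h0 : (bead μ 0 : ZMod ℓ) ≠ residue ℓ (lastBox μ)) (hℓ : 2 ≤ ℓ)
    (hμ : IsCore ℓ μ) :
    lastBox (Phi ℓ μ) = (keptRows ℓ μ (lastRow μ), (lastBox μ).2) := by
  rw [lastBox, (lastRow_Phi h h0 hℓ hμ).2, rowEnd, rowLen_Phi hℓ hμ (lastRow_kept h h0)]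
  rfl

/-- If the first and the last row are not equivalent, deleting the rows equivalent to the first row
commutes with the first step of the recursion for the canonical words. -/
theorem removeResidue_Phi (h : μ ≠ ⊥)
    (h0 : (bead μ 0 : ZMod ℓ) ≠ residue ℓ (lastBox μ)) (hℓ : 2 ≤ ℓ)
    (hμ : IsCore ℓ μ) :
    removeResidue (ℓ - 1) (residue (ℓ - 1) (lastBox (Phi ℓ μ))) (Phi ℓ μ) =
      Phi ℓ (removeResidue ℓ (residue ℓ (lastBox μ)) μ) := by
  have hℓ0 : 0 < ℓ := by omega
  have hP := lastRow_kept h h0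
  obtain ⟨hne, hlast⟩ := lastRow_Phi h h0 hℓ hμ
  have hμ' := isCore_removeResidue hℓ hμ h
  have hrow0 : 0 < μ.rowLen 0 :=
    (rowLen_lastRow_pos h).trans_le (μ.rowLen_anti _ _ (Nat.zero_le _))
  have hkept : ∀ p, 0 < μ.rowLen p → (bead μ p : ZMod ℓ) ≠ bead μ 0 →
      (bead (removeResidue ℓ (residue ℓ (lastBox μ)) μ) p : ZMod ℓ) ≠
        bead (removeResidue ℓ (residue ℓ (lastBox μ)) μ) 0 := by
    intro p hp hp0
    rwa [Ne, runner_removeResidue_eq_iff hℓ0 hμ h hp hrow0]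
  refine ext_rowLen fun r => ?_
  obtain ⟨p, hp, rfl⟩ := exists_keptRows_eq (μ := μ) hℓ r
  rw [rowLen_removeResidue (by omega) (isCore_Phi hℓ hμ) hne, rowLen_Phi hℓ hμ hp]
  rcases Nat.eq_zero_or_pos (μ.rowLen p) with hz | hpos
  · rw [hz, Nat.zero_sub]
    by_contra hcon
    have hmem := YoungDiagram.mem_iff_lt_rowLen.2 (Nat.pos_of_ne_zero (Ne.symm hcon))
    obtain ⟨q, hq, h1, h2⟩ := (mem_Phi hℓ hμ').1 hmem
    have hq' := h2.trans_le (rowLen_removeResidue_le q _)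
    rw [keptRows_removeResidue hℓ0 hμ h hq'] at h1
    have hq0 : (bead μ q : ZMod ℓ) ≠ bead μ 0 := by
      rwa [Ne, runner_removeResidue_eq_iff hℓ0 hμ h hq' hrow0] at hq
    have := μ.rowLen_anti _ _ (le_of_keptRows_le hq0 h1)
    omega
  · rw [← keptRows_removeResidue hℓ0 hμ h hpos, rowLen_Phi hℓ hμ' (hkept p hpos hp),
      rowLen_removeResidue hℓ0 hμ h, keptRows_removeResidue hℓ0 hμ h hpos,
      residue_lastBox hne, hlast, bead_Phi hℓ hμ hp, bead_Phi hℓ hμ hP,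
      residue_lastBox h]
    simp only [intCast_eq_iff_deleted hℓ hp hP]

end PhiRemove

/-! ### The relabelled subword -/

section Relabel

variable {ℓ : ℕ} {μ : YoungDiagram}

theorem relabel_eq {c : ℕ × ℕ} (hc : c ∈ μ) :
    relabel ℓ μ c = residue (ℓ - 1) (keptRows ℓ μ c.1, c.2) := by
  have hpos : ∀ p ≤ c.1, 0 < μ.rowLen p := fun p hp =>
    (Nat.zero_le c.2).trans_lt (YoungDiagram.mem_iff_lt_rowLen.1 (μ.up_left_mem hp le_rfl hc))
  rw [relabel, keptRows, Nat.count_eq_card_filter_range]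
  congr 3
  refine Finset.filter_congr fun s hs => not_congr ?_
  exact rowEquiv_iff (hpos s (Finset.mem_range.1 hs).le) (hpos 0 (Nat.zero_le _))

theorem relabel_removeResidue (hℓ : 0 < ℓ) (hμ : IsCore ℓ μ) (h : μ ≠ ⊥) {c : ℕ × ℕ}
    (hc : c ∈ removeResidue ℓ (residue ℓ (lastBox μ)) μ) :
    relabel ℓ μ c = relabel ℓ (removeResidue ℓ (residue ℓ (lastBox μ)) μ) c := by
  have hc' : c ∈ μ := removeResidue_le _ hc
  rw [relabel_eq hc, relabel_eq hc', keptRows_removeResidue hℓ hμ h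
    ((Nat.zero_le c.2).trans_lt (YoungDiagram.mem_iff_lt_rowLen.1 hc'))]

variable [NeZero ℓ]

theorem suffixCore_zero (hℓ : 2 ≤ ℓ) (hμ : IsCore ℓ μ) : suffixCore ℓ μ 0 = μ :=
  coreOf_canonicalWord hℓ hμ

theorem suffixCore_succ (h : μ ≠ ⊥) (j : ℕ) :
    suffixCore ℓ μ (j + 1) = suffixCore ℓ (removeResidue ℓ (residue ℓ (lastBox μ)) μ) j := by
  rw [suffixCore, canonicalWord_of_ne h, List.drop_succ_cons, suffixCore]

theorem suffixCore_spec (hℓ : 2 ≤ ℓ) (hμ : IsCore ℓ μ) :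
    ∀ (j : ℕ) (hj : j < (canonicalWord ℓ μ).length),
      suffixCore ℓ μ j ≠ ⊥ ∧ (canonicalWord ℓ μ)[j] = residue ℓ (lastBox (suffixCore ℓ μ j)) ∧
        suffixCore ℓ μ j ≤ μ := by
  refine core_induction (P := fun μ => ∀ (j : ℕ) (hj : j < (canonicalWord ℓ μ).length),
      suffixCore ℓ μ j ≠ ⊥ ∧ (canonicalWord ℓ μ)[j] = residue ℓ (lastBox (suffixCore ℓ μ j)) ∧
        suffixCore ℓ μ j ≤ μ) hℓ ?_ ?_ hμ
  · intro j hj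
    simp [canonicalWord_bot] at hj
  · intro μ hμ h _ ih j hj
    cases j with
    | zero =>
      rw [suffixCore_zero hℓ hμ]
      exact ⟨h, by simp [canonicalWord_of_ne h], le_rfl⟩
    | succ j =>
      have hj' := hj
      rw [canonicalWord_of_ne h, List.length_cons, Nat.succ_lt_succ_iff] at hj'
      obtain ⟨h1, h2, h3⟩ := ih j hj'
      rw [suffixCore_succ h]
      refine ⟨h1, ?_, h3.trans (removeResidue_le _)⟩
      rw [← h2]
      simp [canonicalWord_of_ne h]

theorem sort_filter_range (n : ℕ) (p : ℕ → Prop) [DecidablePred p] :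
    ((Finset.range n).filter p).sort (· ≤ ·) = (List.range n).filter p := by
  have h1 : ((List.range n).filter p).toFinset = (Finset.range n).filter p := by
    ext x
    simp
  rw [← h1]
  exact (List.toFinset_sort _ (List.nodup_range.filter _)).2
    ((List.pairwise_le_range (n := n)).filter _)

theorem relabelledSubword_eq : relabelledSubword ℓ μ =
    ((List.range (canonicalWord ℓ μ).length).filter fun j =>
      ¬ RowEquiv ℓ (suffixCore ℓ μ j) 0 (lastRow (suffixCore ℓ μ j))).map
        fun j => relabel ℓ μ (lastBox (suffixCore ℓ μ j)) := by
  rw [relabelledSubword, subexprIndices, sort_filter_range]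

theorem relabelledSubword_bot : relabelledSubword ℓ ⊥ = [] := by
  simp [relabelledSubword_eq, canonicalWord_bot]

theorem relabelledSubword_of_ne (hℓ : 2 ≤ ℓ) (hμ : IsCore ℓ μ) (h : μ ≠ ⊥) :
    relabelledSubword ℓ μ =
      (if RowEquiv ℓ μ 0 (lastRow μ) then [] else [relabel ℓ μ (lastBox μ)]) ++
        relabelledSubword ℓ (removeResidue ℓ (residue ℓ (lastBox μ)) μ) := by
  have hμ' := isCore_removeResidue hℓ hμ h
  have htail : ((List.map Nat.succ (List.range
      (canonicalWord ℓ (removeResidue ℓ (residue ℓ (lastBox μ)) μ)).length)).filter fun j =>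
      ¬ RowEquiv ℓ (suffixCore ℓ μ j) 0 (lastRow (suffixCore ℓ μ j))).map
        (fun j => relabel ℓ μ (lastBox (suffixCore ℓ μ j))) =
      relabelledSubword ℓ (removeResidue ℓ (residue ℓ (lastBox μ)) μ) := by
    rw [relabelledSubword_eq, List.filter_map, List.map_map]
    simp only [Function.comp_def, Nat.succ_eq_add_one, suffixCore_succ h]
    refine List.map_congr_left fun j hj => ?_
    have hj' := List.mem_range.1 (List.mem_of_mem_filter hj)
    obtain ⟨h1, -, h3⟩ := suffixCore_spec hℓ hμ' j hj'
    exact relabel_removeResidue (by omega) hμ h (h3 (lastBox_isRemovable h1).1)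
  rw [← htail, relabelledSubword_eq, canonicalWord_of_ne h, List.length_cons,
    List.range_succ_eq_map, List.filter_cons, suffixCore_zero hℓ hμ]
  split_ifs with h1 h2 h2
  · simp_all
  · simp [suffixCore_zero hℓ hμ]
  · simp
  · simp_all

/-- Each letter of the canonical word of a core either shortens the first row, or survives as a
letter of the canonical word of `Φ`. -/
theorem relabelledSubword_eq_canonicalWord (hℓ : 2 ≤ ℓ) (hμ : IsCore ℓ μ) :
    relabelledSubword ℓ μ = canonicalWord (ℓ - 1) (Phi ℓ μ) ∧
      (canonicalWord (ℓ - 1) (Phi ℓ μ)).length + μ.rowLen 0 = (canonicalWord ℓ μ).length := by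
  refine core_induction (P := fun μ => relabelledSubword ℓ μ = canonicalWord (ℓ - 1) (Phi ℓ μ) ∧
      (canonicalWord (ℓ - 1) (Phi ℓ μ)).length + μ.rowLen 0 = (canonicalWord ℓ μ).length)
    hℓ ?_ ?_ hμ
  · rw [relabelledSubword_bot, Phi_bot hℓ, canonicalWord_bot, canonicalWord_bot, rowLen_bot]
    simp
  · intro μ hμ h _ ⟨ih1, ih2⟩
    have hrow0 : 0 < μ.rowLen 0 :=
      (rowLen_lastRow_pos h).trans_le (μ.rowLen_anti _ _ (Nat.zero_le _))
    have hequiv : RowEquiv ℓ μ 0 (lastRow μ) ↔ (bead μ 0 : ZMod ℓ) = residue ℓ (lastBox μ) := by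
      rw [rowEquiv_iff hrow0 (rowLen_lastRow_pos h), residue_lastBox h]
    rw [rowLen_removeResidue (by omega) hμ h] at ih2
    simp only [hrow0, true_and] at ih2
    rw [relabelledSubword_of_ne hℓ hμ h, ih1, canonicalWord_of_ne h, List.length_cons]
    by_cases h0 : (bead μ 0 : ZMod ℓ) = residue ℓ (lastBox μ)
    · rw [if_pos (hequiv.2 h0), Phi_removeResidue_of_eq hℓ hμ h h0, List.nil_append]
      rw [if_pos h0, Phi_removeResidue_of_eq hℓ hμ h h0] at ih2
      exact ⟨rfl, by omega⟩
    · rw [if_neg (mt hequiv.1 h0), canonicalWord_of_ne (lastRow_Phi h h0 hℓ hμ).1,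
        removeResidue_Phi h h0 hℓ hμ, List.length_cons, List.singleton_append,
        relabel_eq (lastBox_isRemovable h).1, lastBox_Phi h h0 hℓ hμ]
      rw [if_neg h0] at ih2
      exact ⟨rfl, by omega⟩

end Relabel

theorem mainTheorem3 (ℓ : ℕ) (hℓ : 2 ≤ ℓ) [NeZero ℓ] [NeZero (ℓ - 1)] (k : ℕ)
    (μ : YoungDiagram) (hμ : IsCore ℓ μ) (hk : μ.rowLen 0 = k) :
    IsReducedWordOf ℓ (canonicalWord ℓ μ) μ ∧
    (∀ (j : ℕ) (hj : j < (canonicalWord ℓ μ).length),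
      suffixCore ℓ μ j ≠ ⊥ ∧ (canonicalWord ℓ μ)[j] = residue ℓ (lastBox (suffixCore ℓ μ j))) ∧
    IsCore (ℓ - 1) (Phi ℓ μ) ∧ (Phi ℓ μ).rowLen 0 ≤ k ∧
    relabelledSubword ℓ μ = canonicalWord (ℓ - 1) (Phi ℓ μ) ∧
    IsReducedWordOf (ℓ - 1) (relabelledSubword ℓ μ) (Phi ℓ μ) ∧
    coxeterLength (ℓ - 1) (canonicalElement (ℓ - 1) (Phi ℓ μ)) + k =
      coxeterLength ℓ (canonicalElement ℓ μ) := by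
  subst hk
  have hred := isReducedWordOf_canonicalWord hμ
  have hredΦ := isReducedWordOf_canonicalWord (isCore_Phi hℓ hμ)
  obtain ⟨hword, hlen⟩ := relabelledSubword_eq_canonicalWord hℓ hμ
  refine ⟨hred, fun j hj => ?_, isCore_Phi hℓ hμ, rowLen_Phi_zero_le hℓ hμ, hword, ?_, ?_⟩
  · obtain ⟨h1, h2, -⟩ := suffixCore_spec hℓ hμ j hj
    exact ⟨h1, h2⟩
  · rw [hword]
    exact hredΦ
  · rw [canonicalElement, canonicalElement, hred.1, hredΦ.1]
    exact hlen
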